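/- Let $(Y,p)$ be a probability space, $(X,\mu)$ a standard Borel probability space, $\Omega=Y^{\mathbb Z}$, $\mathbb P=p^{\mathbb Z}$, $\bar X=\Omega\times X$, $\bar\mu=\mathbb P\times\mu$, and let $\theta$ be the left shift on $\Omega$. Let $\bar f:\bar X\to\bar X$ be a bimeasurable bijection of the form $\bar f(\omega,x)=(\theta\omega,f_\omega(x))$, where $f_\omega=f_i:X\to X$ depends only on the zeroth coordinate $i=\omega_0$ of $\omega$, and assume that $\bar\mu$ is $\bar f$-invariant and ergodic. Let $G$ be a locally compact, second countable, Hausdorff topological group with its Borel $\sigma$-algebra. A random $G$-valued cocycle $(\bar f,A)$ is given by a measurable map $A:\bar X\to G$ for which there is a family of maps $A_i:X\to G$ ($i\in Y$), with $(i,x)\mapsto A_i(x)$ measurable, such that $A(\omega,x)=A_{\omega_0}(x)$ for $\bar\mu$-almost every $(\omega,x)$. Put $A^0(\bar x)=e$, the identity of $G$, and $A^n(\bar x)=A(\bar f^{\,n-1}(\bar x))\cdots A(\bar f(\bar x))A(\bar x)$ for $n\ge1$. For $D\subset\mathbb N=\{0,1,2,\dots\}$ let $d(D)=\liminf_{n\to\infty}\frac{\#([0,n]\cap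 D)}{n}$. For every random $G$-valued cocycle $(\bar f,A)$ the following are equivalent: 1. $(\bar f,A)$ is essentially bounded: there are a compact set $K\subset G$, a constant $\delta>0$ and a measurable set $E\subset\bar X$ with $\bar\mu(E)>0$ such that $d(\{n\ge0: A^n(\bar x)\in K\})\ge\delta$ for all $\bar x\in E$. 2. There is an $(\bar f,A)$-stationary probability measure $\hat\mu$ on $X\times G$, that is, $\hat\mu$ projects on $\mu$ and $\int_Y (F_i)_*\hat\mu\,dp(i)=\hat\mu$, where $F_i(x,g)=(f_i(x),A_i(x)g)$. 3. $(\bar f,A)$ is cohomologous to a random cocycle with values in a compact subgroup: there are a compact subgroup $H$ of $G$, a random $G$-valued cocycle $(\bar f,B)$ with $B(\bar x)\in H$ for all $\bar x\in\bar X$, and a measurable map $P:X\to G$ such that $B(\omega,x)=P(f_\omega(x))^{-1}A(\omega,x)P(x)$ for $\bar\mu$-almost every $(\omega,x)$. -/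

import Mathlib

open MeasureTheory Filter

/-- The two-sided Bernoulli measure `p^ℤ` on the product space `Ω = Y^ℤ`. -/
noncomputable def bernoulliMeasure {Y : Type*} [MeasurableSpace Y] (p : Measure Y)
    [IsProbabilityMeasure p] : Measure (ℤ → Y) :=
  Measure.infinitePi (fun _ : ℤ => p)

/-- The measure `μ̄ = p^ℤ × μ` on `X̄ = Ω × X`. -/
noncomputable def barMeasure {Y X : Type*} [MeasurableSpace Y] [MeasurableSpace X]
    (p : Measure Y) [IsProbabilityMeasure p] (μ : Measure X) : Measure ((ℤ → Y) × X) :=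
  (bernoulliMeasure p).prod μ

/-- A random transformation: a bimeasurable bijection `f̄` of `X̄ = Y^ℤ × X` of the form
`f̄(ω, x) = (θ ω, f_{ω₀}(x))`, where `θ` is the left shift on `Y^ℤ` and the fibre map depends
only on the zeroth coordinate of `ω`. -/
structure RandomTransformation (Y X : Type*) [MeasurableSpace Y] [MeasurableSpace X] where
  /-- the fibre maps `f_i : X → X`, `i ∈ Y` -/
  fiber : Y → X → X
  /-- the skew-shift `f̄` -/
  skew : ((ℤ → Y) × X) ≃ᵐ ((ℤ → Y) × X)
  skew_apply : ∀ (ω : ℤ → Y) (x : X), skew (ω, x) = (fun n => ω (n + 1), fiber (ω 0) x)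

/-- The dynamically defined products of `A` over `f`:
`A⁰(x) = 1` and `Aⁿ(x) = A(fⁿ⁻¹(x)) ⋯ A(f(x)) A(x)`. -/
def cocycleIter {S G : Type*} [Group G] (f : S → S) (A : S → G) : ℕ → S → G
  | 0, _ => 1
  | n + 1, x => A (f^[n] x) * cocycleIter f A n x

/-- A random `G`-valued cocycle over random transformations with base measure `p^ℤ × μ`: a
measurable `A : X̄ → G` such that `A(ω, x) = A_{ω₀}(x)` for almost every `(ω, x)`, for a
measurable family `A_i : X → G`, `i ∈ Y`. -/
structure RandomCocycle {Y X : Type*} [MeasurableSpace Y] [MeasurableSpace X]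
    (p : Measure Y) [IsProbabilityMeasure p] (μ : Measure X)
    (G : Type*) [MeasurableSpace G] where
  /-- the function `A : X̄ → G` -/
  toFun : (ℤ → Y) × X → G
  measurable_toFun : Measurable toFun
  /-- the functions `A_i : X → G`, `i ∈ Y` -/
  gen : Y → X → G
  measurable_gen : Measurable (Function.uncurry gen)
  ae_eq : ∀ᵐ z ∂(barMeasure p μ), toFun z = gen (z.1 0) z.2

/-- The lower asymptotic density `d(D) = liminf_n #([0,n] ∩ D) / n` of a set of naturals. -/
noncomputable def lowerAsymptoticDensity (D : Set ℕ) : ℝ :=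
  liminf (fun n : ℕ => ((Set.Iic n ∩ D).ncard : ℝ) / (n : ℝ)) atTop

section Notions

variable {Y X G : Type*} [MeasurableSpace Y] [MeasurableSpace X]
  {p : Measure Y} [IsProbabilityMeasure p] {μ : Measure X} [MeasurableSpace G]

/-- `(f̄, A)` is essentially bounded: there are a compact `K ⊆ G`, a constant `δ > 0` and a set
`E ⊆ X̄` of positive measure with `d({n ≥ 0 : Aⁿ(x̄) ∈ K}) ≥ δ` for all `x̄ ∈ E`. -/
def RandomCocycle.IsEssentiallyBounded [Group G] [TopologicalSpace G]
    (f : RandomTransformation Y X) (A : RandomCocycle p μ G) : Prop :=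
  ∃ (K : Set G) (δ : ℝ) (E : Set ((ℤ → Y) × X)),
    IsCompact K ∧ 0 < δ ∧ MeasurableSet E ∧ 0 < barMeasure p μ E ∧
      ∀ z ∈ E, δ ≤ lowerAsymptoticDensity {n : ℕ | cocycleIter f.skew A.toFun n z ∈ K}

/-- The skew-products `F_i(x, z) = (f_i(x), A_i(x) z)` on `X × Z`, for a `G`-space `Z`. -/
def RandomCocycle.skewProduct {Z : Type*} [SMul G Z]
    (f : RandomTransformation Y X) (A : RandomCocycle p μ G) (i : Y) : X × Z → X × Z :=
  fun q => (f.fiber i q.1, A.gen i q.1 • q.2)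

/-- A measure `m` on `X × Z` is `(f̄, A)`-stationary: it projects on `μ` and
`∫_Y F_i m dp(i) = m`. -/
def RandomCocycle.IsStationary {Z : Type*} [MeasurableSpace Z] [SMul G Z]
    (f : RandomTransformation Y X) (A : RandomCocycle p μ G) (m : Measure (X × Z)) : Prop :=
  m.map Prod.fst = μ ∧
    ∀ E : Set (X × Z), MeasurableSet E → ∫⁻ i, (m.map (A.skewProduct f i)) E ∂p = m E

/-- Random cocycles `(f̄, A)` and `(f̄, B)` are cohomologous: there is a measurable `P : X → G`
with `B(ω, x) = P(f_ω(x))⁻¹ A(ω, x) P(x)` for almost every `(ω, x)`. -/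
def RandomCocycle.IsCohomologous [Group G]
    (f : RandomTransformation Y X) (A B : RandomCocycle p μ G) : Prop :=
  ∃ P : X → G, Measurable P ∧
    ∀ᵐ z ∂(barMeasure p μ), B.toFun z = (P (f.fiber (z.1 0) z.2))⁻¹ * A.toFun z * P z.2

end Notions

/-!
Write `q = (x, g)` for the points of `X × G` and `F_i q = (f_i x, A_i(x) g)`. All three conditions
are compared with a fourth one: there is a nonzero `ζ ∈ L²(μ × haar)` with `ζ (F_i q) = ζ q` for
almost every `(i, q)`. The point of working on `X × G`, and not on `Ω × X × G`, is that the
conjugating function obtained from `ζ` does not depend on `ω`.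

*Essential boundedness gives `ζ`.* Since `f̄` preserves `p^ℤ × μ`, the maps `F_i` preserve
`μ × haar` on average over `i`. Hence `Q ψ = ∫ ψ ∘ F_i dp(i)` is a contraction of `L²(μ × haar)`,
and the mean ergodic theorem gives a `Q`-invariant limit of the averages of the indicator of
`X × K V`, for a compact neighbourhood `V` of the identity. Starting in `X × V`, the random walk is
in `X × K V` whenever `Aⁿ ∈ K`, so the limit is nonzero. A `Q`-invariant vector attains equality
in the Cauchy–Schwarz inequality, which makes it invariant under almost every `F_i`
(`ae_comp_eq_of_inner_eq`, `exists_invariant_of_frequently_hitting`,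
`RandomCocycle.IsEssentiallyBounded.exists_invariant`).

*A stationary measure gives `ζ`.* Convolved on the right with the indicator of `V`, it becomes a
stationary measure dominated by `μ × haar`; its density is bounded, and invariant by the same
equality argument (`exists_invariant_of_stationary_le`,
`RandomCocycle.IsStationary.exists_invariant`).

*`ζ` gives a reduction to a compact subgroup.* The function `ξ x = ζ (x, ·)` takes values in
`L²(G)` and satisfies `ξ (f_i x) = A_i(x) · ξ x`. The translation action on `L²(G) \ {0}` is proper
(`exists_isCompact_of_dist_leftTranslate_lt`), so orbits are closed there and stabilisers are
compact. By ergodicity almost all values of `ξ` lie in one orbit `G ξ₀`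
(`RandomCocycle.exists_ae_mem_orbit_of_equivariant`). A Borel section of `g ↦ g ξ₀`
(`exists_measurable_section`) gives a measurable `P` with `ξ x = P(x) ξ₀`, and then
`P(f_i x)⁻¹ A_i(x) P(x)` fixes `ξ₀`.

*Conversely*, if `A` is cohomologous through `P` to a cocycle with values in a compact subgroup `H`,
then the image of `μ × haar_H` under `(x, h) ↦ (x, P(x) h)` is stationary, and `Aⁿ` is in a fixed
compact set whenever `P` is bounded at both ends of the orbit. The latter happens with positive
lower frequency by the maximal ergodic lemma (`measure_birkhoffSum_ge_pos`).
-/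

/-! ### The maximal ergodic lemma -/

section MaximalErgodic

variable {S : Type*}

/-- The running maximum `max_{0 ≤ k ≤ N} S_k φ` of the Birkhoff sums of `φ` along `T`,
in the recursive form `M₀ = 0`, `M_{N+1} = max 0 (φ + M_N ∘ T)`. -/
noncomputable def maxBirkhoffSum (T : S → S) (φ : S → ℝ) : ℕ → S → ℝ
  | 0, _ => 0
  | n + 1, z => max 0 (φ z + maxBirkhoffSum T φ n (T z))

lemma maxBirkhoffSum_nonneg (T : S → S) (φ : S → ℝ) (n : ℕ) (z : S) :
    0 ≤ maxBirkhoffSum T φ n z := by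
  cases n with
  | zero => exact le_rfl
  | succ n => exact le_max_left _ _

lemma maxBirkhoffSum_le_succ (T : S → S) (φ : S → ℝ) (n : ℕ) (z : S) :
    maxBirkhoffSum T φ n z ≤ maxBirkhoffSum T φ (n + 1) z := by
  induction n generalizing z with
  | zero => exact le_max_left _ _
  | succ n ih => exact max_le_max le_rfl (by linarith [ih (T z)])

lemma birkhoffSum_le_maxBirkhoffSum (T : S → S) (φ : S → ℝ) (n : ℕ) (z : S) :
    birkhoffSum T φ n z ≤ maxBirkhoffSum T φ n z := by
  induction n generalizing z with
  | zero => simp [maxBirkhoffSum]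
  | succ n ih =>
    rw [birkhoffSum_succ']
    exact le_trans (by linarith [ih (T z)]) (le_max_right _ _)

variable [MeasurableSpace S]

lemma measurable_maxBirkhoffSum {T : S → S} (hT : Measurable T) {φ : S → ℝ} (hφ : Measurable φ)
    (n : ℕ) : Measurable (maxBirkhoffSum T φ n) := by
  induction n with
  | zero => exact measurable_const
  | succ n ih => exact measurable_const.max (hφ.add (ih.comp hT))

lemma integrable_maxBirkhoffSum {ν : Measure S} {T : S → S} (hT : MeasurePreserving T ν ν)
    {φ : S → ℝ} (hφi : Integrable φ ν) (n : ℕ) :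
    Integrable (maxBirkhoffSum T φ n) ν := by
  induction n with
  | zero => exact integrable_zero _ _ _
  | succ n ih =>
    exact (integrable_zero _ _ _).sup (hφi.add (hT.integrable_comp_of_integrable ih))

/-- Hopf's maximal inequality, by Garsia's argument: on `{M_{N+1} > 0}` one has
`φ = M_{N+1} - M_N ∘ T`, and `∫ M_N ∘ T = ∫ M_N ≤ ∫ M_{N+1}`. -/
lemma setIntegral_maxBirkhoffSum_pos_nonneg {ν : Measure S} {T : S → S}
    (hT : MeasurePreserving T ν ν)
    {φ : S → ℝ} (hφ : Measurable φ) (hφi : Integrable φ ν) (n : ℕ) :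
    0 ≤ ∫ z in {z | 0 < maxBirkhoffSum T φ (n + 1) z}, φ z ∂ν := by
  have hM := measurable_maxBirkhoffSum hT.measurable hφ
  have hMi := integrable_maxBirkhoffSum hT hφi
  have hset : MeasurableSet {z | 0 < maxBirkhoffSum T φ (n + 1) z} :=
    measurableSet_lt measurable_const (hM _)
  have hcomp : Integrable (fun z => maxBirkhoffSum T φ n (T z)) ν :=
    hT.integrable_comp_of_integrable (hMi n)
  have key : ∀ z, maxBirkhoffSum T φ (n + 1) z - maxBirkhoffSum T φ n (T z) ≤
      Set.indicator {z | 0 < maxBirkhoffSum T φ (n + 1) z} φ z := by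
    intro z
    by_cases h : 0 < maxBirkhoffSum T φ (n + 1) z
    · rw [Set.indicator_of_mem (by exact h)]
      have h' : maxBirkhoffSum T φ (n + 1) z = φ z + maxBirkhoffSum T φ n (T z) := by
        rcases lt_max_iff.1 h with h0 | h0
        · exact absurd h0 (lt_irrefl _)
        · exact max_eq_right h0.le
      linarith
    · rw [Set.indicator_of_notMem (by exact h)]
      linarith [maxBirkhoffSum_nonneg T φ n (T z)]
  rw [← integral_indicator hset]
  calc (0 : ℝ) ≤ (∫ z, maxBirkhoffSum T φ (n + 1) z ∂ν) - ∫ z, maxBirkhoffSum T φ n z ∂ν := by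
        exact sub_nonneg.2 (integral_mono (hMi n) (hMi (n + 1)) (maxBirkhoffSum_le_succ T φ n))
    _ = (∫ z, maxBirkhoffSum T φ (n + 1) z ∂ν) - ∫ z, maxBirkhoffSum T φ n (T z) ∂ν := by
        congr 1
        conv_lhs => rw [← hT.map_eq]
        exact integral_map hT.aemeasurable (hM n).aestronglyMeasurable
    _ = ∫ z, (maxBirkhoffSum T φ (n + 1) z - maxBirkhoffSum T φ n (T z)) ∂ν :=
        (integral_sub (hMi _) hcomp).symm
    _ ≤ _ := integral_mono ((hMi _).sub hcomp) (hφi.indicator hset) key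

/-- A substitute for the pointwise ergodic theorem: a measure-preserving map visits a set
of measure larger than `δ` with all partial frequencies at least `δ`, from a set of starting
points of positive measure. -/
lemma measure_birkhoffSum_ge_pos {ν : Measure S} [IsProbabilityMeasure ν] {T : S → S}
    (hT : MeasurePreserving T ν ν) {C : Set S} (hC : MeasurableSet C) {δ : ℝ}
    (hδ : δ < ν.real C) :
    0 < ν {z | ∀ n : ℕ, δ * n ≤ birkhoffSum T (C.indicator fun _ => (1 : ℝ)) n z} := by
  rw [pos_iff_ne_zero]
  intro h0
  set φ : S → ℝ := fun z => δ - C.indicator (fun _ => (1 : ℝ)) z with hφdef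
  have hφ : Measurable φ := measurable_const.sub (measurable_const.indicator hC)
  have hφi : Integrable φ ν :=
    (integrable_const δ).sub ((integrable_const (1 : ℝ)).indicator hC)
  have hint : ∫ z, φ z ∂ν = δ - ν.real C := by
    rw [hφdef, integral_sub (integrable_const δ) ((integrable_const (1 : ℝ)).indicator hC),
      integral_indicator hC]
    simp
  have hsum : ∀ n z, birkhoffSum T φ n z =
      δ * n - birkhoffSum T (C.indicator fun _ => (1 : ℝ)) n z := by
    intro n z
    simp [birkhoffSum, hφdef, Finset.sum_sub_distrib, mul_comm]
  have hpos : ∀ᵐ z ∂ν, ∀ᶠ n in atTop, 0 < maxBirkhoffSum T φ (n + 1) z := by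
    have h1 : ∀ᵐ z ∂ν, ¬ ∀ n : ℕ, δ * n ≤ birkhoffSum T (C.indicator fun _ => (1 : ℝ)) n z :=
      measure_eq_zero_iff_ae_notMem.1 h0
    filter_upwards [h1] with z hz
    push Not at hz
    obtain ⟨k, hk⟩ := hz
    have hmono : Monotone fun n => maxBirkhoffSum T φ n z :=
      monotone_nat_of_le_succ fun n => maxBirkhoffSum_le_succ T φ n z
    filter_upwards [eventually_ge_atTop k] with n hn
    have := birkhoffSum_le_maxBirkhoffSum T φ k z
    rw [hsum] at this
    have h2 : maxBirkhoffSum T φ k z ≤ maxBirkhoffSum T φ (n + 1) z := hmono (by omega)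
    linarith
  have hlim : Tendsto (fun n => ∫ z in {z | 0 < maxBirkhoffSum T φ (n + 1) z}, φ z ∂ν) atTop
      (nhds (∫ z, φ z ∂ν)) := by
    have hs : ∀ n, MeasurableSet {z | 0 < maxBirkhoffSum T φ (n + 1) z} := fun n =>
      measurableSet_lt measurable_const (measurable_maxBirkhoffSum hT.measurable hφ _)
    simp_rw [fun n => (integral_indicator (μ := ν) (f := φ) (hs n)).symm]
    refine tendsto_integral_of_dominated_convergence (fun z => |φ z|)
      (fun n => (hφ.indicator (hs n)).aestronglyMeasurable) hφi.abs
      (fun n => Eventually.of_forall fun z => ?_) ?_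
    · rw [Real.norm_eq_abs]
      by_cases h : z ∈ {z | 0 < maxBirkhoffSum T φ (n + 1) z}
      · rw [Set.indicator_of_mem h]
      · rw [Set.indicator_of_notMem h]; simp
    · filter_upwards [hpos] with z hz
      refine tendsto_const_nhds.congr' ?_
      filter_upwards [hz] with n hn
      rw [Set.indicator_of_mem (by exact hn)]
  have := ge_of_tendsto' hlim fun n => setIntegral_maxBirkhoffSum_pos_nonneg hT hφ hφi n
  linarith

end MaximalErgodic

/-! ### The maps `F_i` and the measures they preserve -/

section Dynamics

variable {Y X G : Type*} [MeasurableSpace Y] [MeasurableSpace X]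
  {p : Measure Y} [IsProbabilityMeasure p] {μ : Measure X}

instance : IsProbabilityMeasure (bernoulliMeasure p) := by
  unfold bernoulliMeasure; infer_instance

instance [IsProbabilityMeasure μ] : IsProbabilityMeasure (barMeasure p μ) := by
  unfold barMeasure; infer_instance

/-- The fibre maps are jointly measurable, since `f̄` restricted to constant sequences is. -/
lemma RandomTransformation.measurable_fiber (f : RandomTransformation Y X) :
    Measurable fun q : Y × X => f.fiber q.1 q.2 := by
  have h : Measurable fun q : Y × X => (f.skew ((fun _ : ℤ => q.1), q.2)).2 :=
    measurable_snd.comp (f.skew.measurable.comp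
      ((measurable_pi_lambda _ fun _ => measurable_fst).prodMk measurable_snd))
  simpa only [f.skew_apply] using h

lemma measurePreserving_zero_coord [IsProbabilityMeasure μ] :
    MeasurePreserving (fun z : (ℤ → Y) × X => (z.1 0, z.2)) (barMeasure p μ) (p.prod μ) := by
  unfold barMeasure bernoulliMeasure
  have h : MeasurePreserving (Function.eval (0 : ℤ)) (Measure.infinitePi fun _ : ℤ => p) p :=
    measurePreserving_eval_infinitePi _ 0
  exact h.prod (MeasurePreserving.id μ)

lemma RandomTransformation.measurePreserving_fiber [IsProbabilityMeasure μ]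
    (f : RandomTransformation Y X)
    (hf : MeasurePreserving f.skew (barMeasure p μ) (barMeasure p μ)) :
    MeasurePreserving (fun q : Y × X => f.fiber q.1 q.2) (p.prod μ) μ := by
  refine ⟨f.measurable_fiber, ?_⟩
  have h1 : MeasurePreserving (fun z : (ℤ → Y) × X => z.2) (barMeasure p μ) μ :=
    measurePreserving_snd
  have h2 := (h1.comp hf).map_eq
  rw [← (measurePreserving_zero_coord (p := p) (μ := μ)).map_eq,
    Measure.map_map f.measurable_fiber
      (measurePreserving_zero_coord (p := p) (μ := μ)).measurable]
  refine Eq.trans (congrArg (fun h => Measure.map h (barMeasure p μ)) ?_) h2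
  ext z
  simp [f.skew_apply z.1 z.2]

lemma ae_barMeasure_iff [IsProbabilityMeasure μ] {r : Y × X → Prop} (hr : MeasurableSet {q | r q}) :
    (∀ᵐ z ∂(barMeasure p μ), r (z.1 0, z.2)) ↔ ∀ᵐ q ∂(p.prod μ), r q := by
  rw [← (measurePreserving_zero_coord (p := p) (μ := μ)).map_eq,
    ae_map_iff measurePreserving_zero_coord.aemeasurable hr]

lemma ae_barMeasure_of_ae [IsProbabilityMeasure μ] {r : Y × X → Prop} (hr : ∀ᵐ q ∂(p.prod μ), r q) :
    ∀ᵐ z ∂(barMeasure p μ), r (z.1 0, z.2) :=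
  (measurePreserving_zero_coord (p := p) (μ := μ)).quasiMeasurePreserving.ae hr

/-- Ergodicity of `f̄`, applied to functions on `X̄` that do not depend on `ω`. -/
lemma RandomTransformation.ae_eq_const_of_fiber_invariant [IsProbabilityMeasure μ]
    (f : RandomTransformation Y X)
    (hf : Ergodic f.skew (barMeasure p μ)) {u : X → ℝ} (hu : Measurable u)
    (h : ∀ᵐ q ∂(p.prod μ), u (f.fiber q.1 q.2) = u q.2) : ∃ c : ℝ, ∀ᵐ x ∂μ, u x = c := by
  have h1 : (fun z : (ℤ → Y) × X => u z.2) ∘ f.skew =ᵐ[barMeasure p μ] fun z => u z.2 := by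
    filter_upwards [ae_barMeasure_of_ae h] with z hz
    simpa [f.skew_apply z.1 z.2] using hz
  obtain ⟨c, hc⟩ := hf.ae_eq_const_of_ae_eq_comp₀
    (hu.comp measurable_snd).nullMeasurable h1
  refine ⟨c, ?_⟩
  have h2 : MeasurePreserving (fun z : (ℤ → Y) × X => z.2) (barMeasure p μ) μ :=
    measurePreserving_snd
  rw [← h2.map_eq, ae_map_iff h2.aemeasurable (measurableSet_eq_fun hu measurable_const)]
  exact hc

variable [Group G] [MeasurableSpace G]

namespace RandomCocycle

variable (f : RandomTransformation Y X) (A : RandomCocycle p μ G)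

lemma measurable_skewProduct_uncurry [MeasurableMul₂ G] :
    Measurable fun t : Y × X × G => A.skewProduct f t.1 t.2 := by
  refine Measurable.prodMk ?_ ?_
  · exact f.measurable_fiber.comp (measurable_fst.prodMk (measurable_fst.comp measurable_snd))
  · exact (A.measurable_gen.comp
      (measurable_fst.prodMk (measurable_fst.comp measurable_snd))).mul
      (measurable_snd.comp measurable_snd)

lemma measurable_skewProduct [MeasurableMul₂ G] (i : Y) :
    Measurable (A.skewProduct (Z := G) f i) :=
  (A.measurable_skewProduct_uncurry f).comp measurable_prodMk_left

/-- The maps `F_i` preserve, on average over `i`, the product of `μ` with a left-invariant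
measure on `G`. -/
lemma measurePreserving_skewProduct [IsProbabilityMeasure μ] [MeasurableMul₂ G]
    {ν : Measure G} [SFinite ν]
    [ν.IsMulLeftInvariant]
    (hf : MeasurePreserving f.skew (barMeasure p μ) (barMeasure p μ)) :
    MeasurePreserving (fun t : Y × X × G => A.skewProduct f t.1 t.2) (p.prod (μ.prod ν))
      (μ.prod ν) := by
  refine ⟨A.measurable_skewProduct_uncurry f, ?_⟩
  have hfib := f.measurePreserving_fiber hf
  refine Measure.ext_of_lintegral _ fun ψ hψ => ?_
  have hF := A.measurable_skewProduct_uncurry f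
  have hs : Measurable fun x : X => ∫⁻ g, ψ (x, g) ∂ν := hψ.lintegral_prod_right'
  rw [lintegral_map hψ hF,
    lintegral_prod (fun t : Y × X × G => ψ (A.skewProduct f t.1 t.2)) (hψ.comp hF).aemeasurable,
    lintegral_prod _ hψ.aemeasurable, ← hfib.lintegral_comp hs,
    lintegral_prod (fun q : Y × X => ∫⁻ g, ψ (f.fiber q.1 q.2, g) ∂ν)
      (hs.comp hfib.measurable).aemeasurable]
  refine lintegral_congr fun i => ?_
  rw [lintegral_prod (fun q : X × G => ψ (A.skewProduct f i q))
    (hψ.comp (A.measurable_skewProduct f i)).aemeasurable]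
  refine lintegral_congr fun x => ?_
  exact lintegral_mul_left_eq_self (fun g => ψ (f.fiber i x, g)) (A.gen i x)

end RandomCocycle

end Dynamics

/-! ### Borel sections of continuous maps on σ-compact spaces -/

section BorelSection

variable {W : Type*} [TopologicalSpace W] [T2Space W] [MeasurableSpace W] [BorelSpace W]

/-- The section sends `w` to the least point of its fibre in the Cantor set; the sublevel sets
of this function are images of compact sets. -/
lemma exists_measurable_section_cantorSet {φ : cantorSet → W} (hφ : Continuous φ) :
    ∃ s : W → cantorSet, Measurable s ∧ ∀ w ∈ Set.range φ, φ (s w) = w := by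
  classical
  have hcpt : CompactSpace cantorSet := isCompact_iff_compactSpace.1 isCompact_cantorSet
  have hleast : ∀ w ∈ Set.range φ, ∃ t : cantorSet, IsLeast (φ ⁻¹' {w}) t := fun w hw =>
    (isClosed_singleton.preimage hφ).isCompact.exists_isLeast
      (by obtain ⟨t, rfl⟩ := hw; exact ⟨t, rfl⟩)
  let z : cantorSet := ⟨0, zero_mem_cantorSet⟩
  have : Nonempty cantorSet := ⟨z⟩
  choose! t ht using hleast
  let s : W → cantorSet := fun w => if w ∈ Set.range φ then t w else z
  have hs : ∀ w ∈ Set.range φ, s w = t w := fun w hw => if_pos hw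
  have hs' : ∀ w ∉ Set.range φ, s w = z := fun w hw => if_neg hw
  refine ⟨s, ?_, fun w hw => by rw [hs w hw]; exact (ht w hw).1⟩
  suffices h : Measurable fun w => (s w : ℝ) from h.subtype_mk (h := fun w => (s w).2)
  have hrange : MeasurableSet (Set.range φ) := (isCompact_range hφ).isClosed.measurableSet
  refine measurable_of_Iic fun a => ?_
  have hset : (fun w => (s w : ℝ)) ⁻¹' Set.Iic a =
      φ '' {c | (c : ℝ) ≤ a} ∪ ((Set.range φ)ᶜ ∩ {_w | (0 : ℝ) ≤ a}) := by
    ext w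
    by_cases hw : w ∈ Set.range φ
    · simp only [Set.mem_preimage, Set.mem_Iic, hs w hw, Set.mem_union, Set.mem_inter_iff,
        Set.mem_compl_iff, hw, not_true_eq_false, false_and, or_false]
      constructor
      · exact fun h => ⟨t w, h, (ht w hw).1⟩
      · rintro ⟨c, hc, hcw⟩
        exact le_trans (Subtype.coe_le_coe.2 ((ht w hw).2 hcw)) hc
    · have : ¬ w ∈ φ '' {c | (c : ℝ) ≤ a} := fun h => hw (Set.image_subset_range _ _ h)
      simp [hs' w hw, hw, this, z]
  rw [hset]
  have hcl : IsClosed {c : cantorSet | (c : ℝ) ≤ a} :=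
    isClosed_le continuous_subtype_val continuous_const
  exact (hcl.isCompact.image hφ).isClosed.measurableSet.union
    (hrange.compl.inter (MeasurableSet.const _))

variable {S : Type*} [TopologicalSpace S] [T2Space S] [SecondCountableTopology S]
  [MeasurableSpace S] [BorelSpace S] [RegularSpace S] [Nonempty S]

/-- Reduces to the Cantor set, of which every nonempty compact metrizable space is a continuous
image. -/
lemma exists_measurable_section_of_isCompact {φ : S → W} (hφ : Continuous φ) {K : Set S}
    (hK : IsCompact K) : ∃ s : W → S, Measurable s ∧ ∀ w ∈ φ '' K, φ (s w) = w := by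
  rcases K.eq_empty_or_nonempty with rfl | hne
  · exact ⟨fun _ => Classical.arbitrary S, measurable_const, by simp⟩
  have : CompactSpace K := isCompact_iff_compactSpace.1 hK
  have : Nonempty K := hne.to_subtype
  let _ := TopologicalSpace.metrizableSpaceMetric K
  obtain ⟨ψ, hψ, hsurj⟩ := exists_nat_bool_continuous_surjective_of_compact K
  have hψ' : Continuous fun c => (ψ (cantorSetHomeomorphNatToBool c) : S) :=
    continuous_subtype_val.comp (hψ.comp cantorSetHomeomorphNatToBool.continuous)
  obtain ⟨s, hs, hsec⟩ := exists_measurable_section_cantorSet (hφ.comp hψ')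
  refine ⟨_, hψ'.measurable.comp hs, ?_⟩
  rintro w ⟨k, hk, rfl⟩
  refine hsec _ ?_
  obtain ⟨b, hb⟩ := hsurj ⟨k, hk⟩
  exact ⟨cantorSetHomeomorphNatToBool.symm b, by simp [hb]⟩

lemma exists_measurable_section [SigmaCompactSpace S] {φ : S → W} (hφ : Continuous φ) :
    ∃ s : W → S, Measurable s ∧ ∀ w ∈ Set.range φ, φ (s w) = w := by
  classical
  choose s hs hsec using fun n : ℕ =>
    exists_measurable_section_of_isCompact hφ (isCompact_compactCovering S n)
  have himage : ∀ n, MeasurableSet (φ '' compactCovering S n) := fun n =>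
    ((isCompact_compactCovering S n).image hφ).isClosed.measurableSet
  have hrange : Set.range φ = ⋃ n, φ '' compactCovering S n := by
    rw [← Set.image_iUnion, iUnion_compactCovering, Set.image_univ]
  have hrm : MeasurableSet (Set.range φ) := by
    rw [hrange]; exact MeasurableSet.iUnion himage
  have hex : ∀ w : W, ∃ n, w ∈ φ '' compactCovering S n ∪ (Set.range φ)ᶜ := by
    intro w
    by_cases hw : w ∈ Set.range φ
    · rw [hrange] at hw
      obtain ⟨n, hn⟩ := Set.mem_iUnion.1 hw
      exact ⟨n, Or.inl hn⟩
    · exact ⟨0, Or.inr hw⟩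
  refine ⟨fun w => s (Nat.find (hex w)) w,
    Measurable.find (p := fun n w => w ∈ φ '' compactCovering S n ∪ (Set.range φ)ᶜ) hs
      (fun n => (himage n).union hrm.compl) hex, fun w hw => ?_⟩
  rcases Nat.find_spec (hex w) with h | h
  · exact hsec _ w h
  · exact absurd hw h

end BorelSection

/-! ### The translation action on `L²` of a locally compact group -/

section Translation

open Measure
open scoped ENNReal Pointwise

variable {G : Type*} [Group G] [TopologicalSpace G] [IsTopologicalGroup G] [LocallyCompactSpace G]
  [SecondCountableTopology G] [MeasurableSpace G] [BorelSpace G]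

/-- The left translate `h ↦ ξ (g⁻¹ h)` of `ξ ∈ L²(G)`. -/
noncomputable def leftTranslate (g : G) (ξ : Lp ℝ 2 (haar : Measure G)) :
    Lp ℝ 2 (haar : Measure G) :=
  DomMulAct.mk g⁻¹ • ξ

lemma leftTranslate_one (ξ : Lp ℝ 2 (haar : Measure G)) : leftTranslate 1 ξ = ξ := by
  simp [leftTranslate]

lemma leftTranslate_mul (g h : G) (ξ : Lp ℝ 2 (haar : Measure G)) :
    leftTranslate (g * h) ξ = leftTranslate g (leftTranslate h ξ) := by
  simp only [leftTranslate, mul_inv_rev, smul_smul]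
  rfl

lemma dist_leftTranslate (g : G) (ξ η : Lp ℝ 2 (haar : Measure G)) :
    dist (leftTranslate g ξ) (leftTranslate g η) = dist ξ η :=
  dist_smul _ _ _

lemma norm_leftTranslate (g : G) (ξ : Lp ℝ 2 (haar : Measure G)) : ‖leftTranslate g ξ‖ = ‖ξ‖ :=
  DomMulAct.norm_smul_Lp _ _

lemma continuous_leftTranslate (ξ : Lp ℝ 2 (haar : Measure G)) :
    Continuous fun g : G => leftTranslate g ξ := by
  have : Fact ((2 : ℝ≥0∞) ≠ ∞) := ⟨by simp⟩
  have h : Continuous fun g : G => DomMulAct.mk g⁻¹ :=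
    DomMulAct.continuous_mk.comp continuous_inv
  exact h.smul continuous_const

lemma leftTranslate_sub (g : G) (ξ η : Lp ℝ 2 (haar : Measure G)) :
    leftTranslate g (ξ - η) = leftTranslate g ξ - leftTranslate g η :=
  DomMulAct.smul_Lp_sub _ _ _

lemma eq_leftTranslate_of_ae_eq {g : G} {ξ η : Lp ℝ 2 (haar : Measure G)}
    (h : ∀ᵐ a ∂(haar : Measure G), η (g * a) = ξ a) : η = leftTranslate g ξ := by
  have h1 : DomMulAct.mk g • η = ξ := by
    refine Lp.ext ?_
    filter_upwards [DomMulAct.smul_Lp_ae_eq (DomMulAct.mk g) η, h] with a ha ha'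
    rw [ha]
    exact ha'
  rw [leftTranslate, ← h1, smul_smul, ← DomMulAct.mk_mul]
  simp

/-- The translation action on `L²(G) \ {0}` is proper: the `g` that bring `ξ` close to `η ≠ 0`
form a relatively compact set. When `ξ` and `η` have supports in a compact set `K`, the translate
of `ξ` by `g ∉ K K⁻¹` is orthogonal to `η`; such functions are dense. -/
lemma exists_isCompact_of_dist_leftTranslate_lt [T2Space G] (ξ : Lp ℝ 2 (haar : Measure G))
    {η : Lp ℝ 2 (haar : Measure G)} (hη : η ≠ 0) :
    ∃ C : Set G, IsCompact C ∧ ∀ g, dist (leftTranslate g ξ) η < ‖η‖ / 2 → g ∈ C := by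
  have hη0 : 0 < ‖η‖ := norm_pos_iff.2 hη
  have happrox : ∀ θ : Lp ℝ 2 (haar : Measure G), ∃ (k : G → ℝ) (hk : MemLp k 2 (haar : Measure G)),
      HasCompactSupport k ∧ ‖θ - hk.toLp k‖ ≤ ‖η‖ / 8 := by
    intro θ
    obtain ⟨k, hks, hkd, -, hk⟩ := (Lp.memLp θ).exists_hasCompactSupport_eLpNorm_sub_le
      (by simp) (ε := ENNReal.ofReal (‖η‖ / 8)) (by simpa using hη)
    refine ⟨k, hk, hks, ?_⟩
    have h2 : eLpNorm (⇑θ - k) 2 haar = ‖θ - hk.toLp k‖ₑ := by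
      rw [Lp.enorm_def]
      refine eLpNorm_congr_ae ?_
      filter_upwards [Lp.coeFn_sub θ (hk.toLp k), hk.coeFn_toLp] with a h1 h2
      rw [h1, Pi.sub_apply, Pi.sub_apply, h2]
    rw [h2, ← ofReal_norm] at hkd
    exact (ENNReal.ofReal_le_ofReal_iff (by positivity)).1 hkd
  obtain ⟨k, hk, hks, hkd⟩ := happrox ξ
  obtain ⟨l, hl, hls, hld⟩ := happrox η
  refine ⟨tsupport l * (tsupport k)⁻¹, hls.isCompact.mul hks.isCompact.inv, fun g hg => ?_⟩
  by_contra hgC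
  have horth : inner ℝ (leftTranslate g (hk.toLp k)) (hl.toLp l) = 0 := by
    rw [L2.inner_def]
    refine integral_eq_zero_of_ae ?_
    have h1 : leftTranslate g (hk.toLp k) =ᵐ[haar] fun a => k (g⁻¹ * a) := by
      rw [leftTranslate, DomMulAct.mk_smul_toLp]
      exact MemLp.coeFn_toLp _
    filter_upwards [h1, hl.coeFn_toLp] with a h1 h2
    rw [h1, h2]
    by_cases hla : l a = 0
    · simp [hla]
    by_cases hka : k (g⁻¹ * a) = 0
    · simp [hka]
    exact absurd ⟨a, subset_tsupport l hla, (g⁻¹ * a)⁻¹,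
      Set.inv_mem_inv.2 (subset_tsupport k hka), by simp⟩ hgC
  -- By Pythagoras the distance from `g k` to `l` is at least `‖l‖`, which is close to `‖η‖`.
  have hge : ‖hl.toLp l‖ ≤ ‖leftTranslate g (hk.toLp k) - hl.toLp l‖ := by
    have h3 := norm_sub_sq_real (leftTranslate g (hk.toLp k)) (hl.toLp l)
    rw [horth] at h3
    refine le_of_sq_le_sq ?_ (norm_nonneg _)
    nlinarith [sq_nonneg ‖leftTranslate g (hk.toLp k)‖]
  have h4 : ‖leftTranslate g ξ - leftTranslate g (hk.toLp k)‖ ≤ ‖η‖ / 8 := by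
    rw [← leftTranslate_sub, norm_leftTranslate]; exact hkd
  have h5 : ‖leftTranslate g (hk.toLp k) - hl.toLp l‖ ≤
      ‖leftTranslate g ξ - leftTranslate g (hk.toLp k)‖ + dist (leftTranslate g ξ) η
        + ‖η - hl.toLp l‖ := by
    rw [dist_eq_norm]
    calc ‖leftTranslate g (hk.toLp k) - hl.toLp l‖
        = ‖-(leftTranslate g ξ - leftTranslate g (hk.toLp k)) + (leftTranslate g ξ - η)
          + (η - hl.toLp l)‖ := by congr 1; abel
      _ ≤ _ := by
        refine (norm_add₃_le).trans ?_
        rw [norm_neg]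
  have h6 : ‖η‖ ≤ ‖η - hl.toLp l‖ + ‖hl.toLp l‖ := by
    simpa using norm_add_le (η - hl.toLp l) (hl.toLp l)
  linarith

/-- The stabiliser of a vector of `L²(G)` under translations. -/
def translationStabilizer (ξ : Lp ℝ 2 (haar : Measure G)) : Subgroup G where
  carrier := {g | leftTranslate g ξ = ξ}
  mul_mem' {a b} ha hb := by
    change leftTranslate (a * b) ξ = ξ
    rw [leftTranslate_mul, show leftTranslate b ξ = ξ from hb, show leftTranslate a ξ = ξ from ha]
  one_mem' := leftTranslate_one ξ
  inv_mem' {a} ha := by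
    change leftTranslate a⁻¹ ξ = ξ
    conv_lhs => rw [← show leftTranslate a ξ = ξ from ha]
    rw [← leftTranslate_mul, inv_mul_cancel, leftTranslate_one]

lemma mem_translationStabilizer {ξ : Lp ℝ 2 (haar : Measure G)} {g : G} :
    g ∈ translationStabilizer ξ ↔ leftTranslate g ξ = ξ := Iff.rfl

lemma isCompact_translationStabilizer [T2Space G] {ξ : Lp ℝ 2 (haar : Measure G)} (hξ : ξ ≠ 0) :
    IsCompact (translationStabilizer ξ : Set G) := by
  obtain ⟨C, hC, h⟩ := exists_isCompact_of_dist_leftTranslate_lt ξ hξ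
  refine hC.of_isClosed_subset (isClosed_eq (continuous_leftTranslate ξ) continuous_const)
    fun g hg => h g ?_
  rw [show leftTranslate g ξ = ξ from hg, dist_self]
  exact half_pos (norm_pos_iff.2 hξ)

lemma mem_range_leftTranslate_of_mem_closure [T2Space G]
    {ξ η : Lp ℝ 2 (haar : Measure G)} (hη : η ≠ 0)
    (h : η ∈ closure (Set.range fun g : G => leftTranslate g ξ)) :
    η ∈ Set.range fun g : G => leftTranslate g ξ := by
  obtain ⟨C, hC, hCξ⟩ := exists_isCompact_of_dist_leftTranslate_lt ξ hη
  have hcl : IsClosed ((fun g : G => leftTranslate g ξ) '' C) :=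
    (hC.image (continuous_leftTranslate ξ)).isClosed
  refine Set.image_subset_range _ C (hcl.closure_subset ?_)
  rw [Metric.mem_closure_iff] at h ⊢
  intro ε hε
  obtain ⟨-, ⟨g, rfl⟩, hg⟩ := h (min ε (‖η‖ / 2)) (lt_min hε (half_pos (norm_pos_iff.2 hη)))
  refine ⟨_, ⟨g, hCξ g ?_, rfl⟩, hg.trans_le (min_le_left _ _)⟩
  rw [dist_comm]
  exact hg.trans_le (min_le_right _ _)

lemma infDist_leftTranslate (g : G) (ξ η : Lp ℝ 2 (haar : Measure G)) :
    Metric.infDist (leftTranslate g η) (Set.range fun a : G => leftTranslate a ξ) =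
      Metric.infDist η (Set.range fun a : G => leftTranslate a ξ) := by
  have key : ∀ (g : G) (η : Lp ℝ 2 (haar : Measure G)),
      Metric.infDist (leftTranslate g η) (Set.range fun a : G => leftTranslate a ξ) ≤
        Metric.infDist η (Set.range fun a : G => leftTranslate a ξ) := by
    intro g η
    refine (Metric.le_infDist (Set.range_nonempty _)).2 ?_
    rintro - ⟨a, rfl⟩
    rw [← dist_leftTranslate g η, ← leftTranslate_mul]
    exact Metric.infDist_le_dist_of_mem ⟨g * a, rfl⟩
  refine le_antisymm (key g η) ?_
  have := key g⁻¹ (leftTranslate g η)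
  rwa [← leftTranslate_mul, inv_mul_cancel, leftTranslate_one] at this

end Translation

/-! ### Fibres of square-integrable functions on a product -/

section Fibres

open scoped ENNReal

/-- Closed sets are zero sets of distances to countable sets. -/
lemma measurable_of_edist_measurable {X W : Type*} [MeasurableSpace X] [PseudoEMetricSpace W]
    [SecondCountableTopology W] [MeasurableSpace W] [BorelSpace W] {ξ : X → W}
    (h : ∀ w, Measurable fun x => edist (ξ x) w) : Measurable ξ := by
  refine measurable_of_isClosed fun F hF => ?_
  obtain ⟨D, hDF, hDc, hD⟩ :=
    (TopologicalSpace.IsSeparable.of_separableSpace F).exists_countable_dense_subset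
  have hcl : closure D = F := subset_antisymm (hF.closure_subset_iff.2 hDF) hD
  have hset : ξ ⁻¹' F = {x | ⨅ w ∈ D, edist (ξ x) w = 0} := by
    ext x
    rw [Set.mem_preimage, ← hcl, Metric.mem_closure_iff_infEDist_zero]
    rfl
  rw [hset]
  exact (Measurable.biInf D hDc fun w _ => h w) (measurableSet_singleton 0)

/-- A square-integrable function on a product defines a measurable family of vectors of `L²`. -/
lemma exists_measurable_fibre {X S : Type*} [MeasurableSpace X] [MeasurableSpace S]
    {μ : Measure X} [SFinite μ] {ν : Measure S} [SFinite ν] [IsSeparable ν]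
    [MeasurableSpace (Lp ℝ 2 ν)] [BorelSpace (Lp ℝ 2 ν)]
    {ζ : X × S → ℝ} (hζ : Measurable ζ) (hζ2 : MemLp ζ 2 (μ.prod ν)) :
    ∃ ξ : X → Lp ℝ 2 ν, Measurable ξ ∧ ∀ᵐ x ∂μ, ξ x =ᵐ[ν] fun g => ζ (x, g) := by
  classical
  have : Fact ((2 : ℝ≥0∞) ≠ ∞) := ⟨by simp⟩
  have hslice : ∀ x, Measurable fun g => ζ (x, g) := fun x => hζ.comp measurable_prodMk_left
  have hnorm : ∀ w : S → ℝ, Measurable w →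
      Measurable fun x => eLpNorm (fun g => ζ (x, g) - w g) 2 ν := by
    intro w hw
    simp_rw [eLpNorm_eq_lintegral_rpow_enorm_toReal (p := 2) (by simp) (by simp)]
    refine Measurable.pow_const ?_ _
    refine Measurable.lintegral_prod_right' (f := fun q : X × S =>
      ‖ζ q - w q.2‖ₑ ^ (2 : ℝ≥0∞).toReal) ?_
    exact (hζ.sub (hw.comp measurable_snd)).enorm.pow_const _
  -- On the null set where the fibre is not square-integrable, `ξ x` is set to `0`.
  have hgood : MeasurableSet {x | MemLp (fun g => ζ (x, g)) 2 ν} := by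
    have : {x | MemLp (fun g => ζ (x, g)) 2 ν} =
        {x | eLpNorm (fun g => ζ (x, g) - (0 : S → ℝ) g) 2 ν < ∞} := by
      ext x
      simp [MemLp, (hslice x).aestronglyMeasurable]
    rw [this]
    exact measurableSet_lt (hnorm 0 measurable_zero) measurable_const
  refine ⟨fun x => if h : MemLp (fun g => ζ (x, g)) 2 ν then h.toLp _ else 0, ?_, ?_⟩
  · refine measurable_of_edist_measurable fun w => ?_
    have hw := (Lp.stronglyMeasurable w).measurable
    have : (fun x => edist (if h : MemLp (fun g => ζ (x, g)) 2 ν then h.toLp _ else 0) w) =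
        fun x => if x ∈ {x | MemLp (fun g => ζ (x, g)) 2 ν} then
          eLpNorm (fun g => ζ (x, g) - w g) 2 ν else edist 0 w := by
      ext x
      by_cases h : MemLp (fun g => ζ (x, g)) 2 ν
      · rw [dif_pos h, if_pos (by exact h), Lp.edist_def]
        refine eLpNorm_congr_ae ?_
        filter_upwards [h.coeFn_toLp] with g hg
        rw [Pi.sub_apply, hg]
      · rw [dif_neg h, if_neg (by exact h)]
    rw [this]
    exact Measurable.ite hgood (hnorm w hw) measurable_const
  · have hint : ∀ᵐ x ∂μ, ∫⁻ g, ‖ζ (x, g)‖ₑ ^ (2 : ℝ) ∂ν < ∞ := by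
      refine ae_lt_top (Measurable.lintegral_prod_right' (f := fun q : X × S =>
        ‖ζ q‖ₑ ^ (2 : ℝ)) (hζ.enorm.pow_const _)) ?_
      rw [← lintegral_prod (fun q : X × S => ‖ζ q‖ₑ ^ (2 : ℝ))
        (hζ.enorm.pow_const _).aemeasurable]
      have := (eLpNorm_lt_top_iff_lintegral_rpow_enorm_lt_top (p := 2) (by simp) (by simp)).1 hζ2.2
      simpa using this.ne
    filter_upwards [hint] with x hx
    have h : MemLp (fun g => ζ (x, g)) 2 ν := by
      refine ⟨(hslice x).aestronglyMeasurable, ?_⟩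
      rw [eLpNorm_lt_top_iff_lintegral_rpow_enorm_lt_top (p := 2) (by simp) (by simp)]
      simpa using hx
    rw [dif_pos h]
    exact h.coeFn_toLp

end Fibres

/-! ### Invariant vectors from the mean ergodic theorem -/

section MeanErgodic

open scoped ENNReal

variable {Y Z : Type*} [MeasurableSpace Y] [MeasurableSpace Z] {p : Measure Y}
  [IsProbabilityMeasure p] {l : Measure Z} [SFinite l] {F : Y × Z → Z}

omit [SFinite l] in
lemma memLp_two_of_integrable_of_mem_Icc {h : Z → ℝ} (hh : Integrable h l)
    (h01 : ∀ᵐ q ∂l, h q ∈ Set.Icc (0 : ℝ) 1) : MemLp h 2 l := by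
  refine (memLp_two_iff_integrable_sq hh.aestronglyMeasurable).2
    (hh.mono (hh.aestronglyMeasurable.pow 2) ?_)
  filter_upwards [h01] with q hq
  rw [Real.norm_of_nonneg (by positivity), Real.norm_of_nonneg hq.1]
  exact pow_le_of_le_one hq.1 hq.2 two_ne_zero

/-- If `⟪ζ ∘ F, ζ ∘ snd⟫ = ‖ζ‖²` then equality holds in the Cauchy–Schwarz inequality, and `ζ` is
invariant under almost every `F (i, ·)`. -/
lemma ae_comp_eq_of_inner_eq (hF : MeasurePreserving F (p.prod l) l) (ζ : Lp ℝ 2 l)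
    (h : inner ℝ (Lp.compMeasurePreservingₗᵢ ℝ F hF ζ)
      (Lp.compMeasurePreservingₗᵢ ℝ Prod.snd (measurePreserving_snd (μ := p) (ν := l)) ζ) =
        ‖ζ‖ ^ 2) :
    ∀ᵐ t ∂(p.prod l), ζ (F t) = ζ t.2 := by
  set T := Lp.compMeasurePreservingₗᵢ (E := ℝ) (p := 2) ℝ F hF
  set J := Lp.compMeasurePreservingₗᵢ (E := ℝ) (p := 2) ℝ Prod.snd
    (measurePreserving_snd (μ := p) (ν := l))
  have h1 : T ζ = J ζ := by
    have h2 := norm_sub_sq_real (T ζ) (J ζ)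
    rw [h, T.norm_map, J.norm_map] at h2
    have h3 : ‖T ζ - J ζ‖ = 0 := by
      refine pow_eq_zero_iff (n := 2) (by norm_num) |>.1 ?_
      rw [h2]; ring
    exact sub_eq_zero.1 (norm_eq_zero.1 h3)
  have hT : T ζ =ᵐ[p.prod l] ζ ∘ F := Lp.coeFn_compMeasurePreserving ζ hF
  have hJ : J ζ =ᵐ[p.prod l] ζ ∘ Prod.snd := Lp.coeFn_compMeasurePreserving ζ _
  filter_upwards [hT, hJ] with t h4 h5
  rw [h1, h5] at h4
  exact h4.symm

/-- The `n`-step transition probability from `q` into `S` for the random walk on `Z` that moves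
by `F (i, ·)` with `i` distributed according to `p`. -/
noncomputable def hittingProb (p : Measure Y) (F : Y × Z → Z) (S : Set Z) : ℕ → Z → ℝ
  | 0, q => S.indicator (fun _ => 1) q
  | n + 1, q => ∫ i, hittingProb p F S n (F (i, q)) ∂p

omit [MeasurableSpace Z] in
lemma hittingProb_mem_Icc (S : Set Z) (n : ℕ) (q : Z) :
    hittingProb p F S n q ∈ Set.Icc (0 : ℝ) 1 := by
  induction n generalizing q with
  | zero =>
    by_cases h : q ∈ S <;> simp [hittingProb, h]
  | succ n ih =>
    refine ⟨integral_nonneg fun i => (ih _).1, ?_⟩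
    have h := integral_mono_of_nonneg (μ := p) (Eventually.of_forall fun i => (ih (F (i, q))).1)
      (integrable_const (1 : ℝ)) (Eventually.of_forall fun i => (ih (F (i, q))).2)
    simpa [hittingProb] using h

lemma integrable_hittingProb (hF : MeasurePreserving F (p.prod l) l) {S : Set Z}
    (hS : MeasurableSet S) (hSf : l S ≠ ∞) (n : ℕ) : Integrable (hittingProb p F S n) l := by
  induction n with
  | zero => exact (integrable_indicator_iff hS).2 (integrableOn_const hSf)
  | succ n ih => exact (hF.integrable_comp_of_integrable ih).integral_prod_right


lemma memLp_hittingProb (hF : MeasurePreserving F (p.prod l) l) {S : Set Z}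
    (hS : MeasurableSet S) (hSf : l S ≠ ∞) (n : ℕ) : MemLp (hittingProb p F S n) 2 l :=
  memLp_two_of_integrable_of_mem_Icc (integrable_hittingProb hF hS hSf n)
    (Eventually.of_forall fun q => hittingProb_mem_Icc S n q)

/-- If a set `S` of finite measure is visited, on average over a set `V` of finite measure, with
positive lower frequency, then there is a nonzero square-integrable invariant function: the limit
of the averages of `1_S` under the Markov operator, which is a contraction of `L²`. -/
lemma exists_invariant_of_frequently_hitting (hF : MeasurePreserving F (p.prod l) l) {S V : Set Z}
    (hS : MeasurableSet S) (hSf : l S ≠ ∞) (hV : MeasurableSet V) (hVf : l V ≠ ∞) {c : ℝ}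
    (hc : 0 < c)
    (h : ∀ᶠ N : ℕ in atTop,
      c * N ≤ ∑ n ∈ Finset.range N, ∫ q in V, hittingProb p F S n q ∂l) :
    ∃ ζ : Lp ℝ 2 l, ζ ≠ 0 ∧ ∀ᵐ t ∂(p.prod l), ζ (F t) = ζ t.2 := by
  set T := Lp.compMeasurePreservingₗᵢ (E := ℝ) (p := 2) ℝ F hF
  set J := Lp.compMeasurePreservingₗᵢ (E := ℝ) (p := 2) ℝ Prod.snd
    (measurePreserving_snd (μ := p) (ν := l))
  -- The Markov operator `Q ψ (q) = ∫ ψ (F (i, q)) dp(i)` on `L²`.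
  set Q : Lp ℝ 2 l →L[ℝ] Lp ℝ 2 l :=
    (ContinuousLinearMap.adjoint J.toContinuousLinearMap).comp T.toContinuousLinearMap
  have hQ : ∀ ψ χ : Lp ℝ 2 l, inner ℝ (Q ψ) χ = inner ℝ (T ψ) (J χ) := fun ψ χ =>
    ContinuousLinearMap.adjoint_inner_left J.toContinuousLinearMap χ (T ψ)
  have hQ1 : ‖Q‖ ≤ 1 := by
    refine (ContinuousLinearMap.opNorm_comp_le _ _).trans ?_
    rw [LinearIsometryEquiv.norm_map]
    exact mul_le_one₀ J.norm_toContinuousLinearMap_le (norm_nonneg _)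
      T.norm_toContinuousLinearMap_le
  have hmem := memLp_hittingProb hF hS hSf
  have hstep : ∀ n, Q ((hmem n).toLp _) = (hmem (n + 1)).toLp _ := by
    intro n
    refine ext_inner_right ℝ fun χ => ?_
    rw [hQ, L2.inner_def, L2.inner_def]
    have hT : T ((hmem n).toLp _) =ᵐ[p.prod l] fun t => hittingProb p F S n (F t) := by
      refine (Lp.coeFn_compMeasurePreserving _ hF).trans ?_
      exact hF.quasiMeasurePreserving.ae (hmem n).coeFn_toLp
    have hJ : J χ =ᵐ[p.prod l] fun t => χ t.2 := Lp.coeFn_compMeasurePreserving χ _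
    have hcongr : (fun t => inner ℝ (T ((hmem n).toLp _) t) (J χ t)) =ᵐ[p.prod l]
        fun t => hittingProb p F S n (F t) * χ t.2 := by
      filter_upwards [hT, hJ] with t h1 h2
      rw [h1, h2]
      simp [mul_comm]
    have hint : Integrable (fun t : Y × Z => hittingProb p F S n (F t) * χ t.2) (p.prod l) :=
      (L2.integrable_inner (𝕜 := ℝ) (T ((hmem n).toLp _)) (J χ)).congr hcongr
    rw [integral_congr_ae hcongr, integral_prod_symm _ hint]
    refine integral_congr_ae ?_
    filter_upwards [(hmem (n + 1)).coeFn_toLp] with q hq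
    rw [hq]
    simp [hittingProb, integral_mul_const, mul_comm]
  have hiter : ∀ n, (Q^[n]) ((hmem 0).toLp _) = (hmem n).toLp _ := by
    intro n
    induction n with
    | zero => rfl
    | succ n ih => rw [Function.iterate_succ_apply', ih, hstep]
  have hlim := Q.tendsto_birkhoffAverage_orthogonalProjection hQ1 ((hmem 0).toLp _)
  set ζ' := (Q.eqLocus (1 : Lp ℝ 2 l →L[ℝ] Lp ℝ 2 l)).orthogonalProjectionOnto ((hmem 0).toLp _)
  have hfix : Q ζ' = ζ' := ζ'.2
  refine ⟨ζ', fun h0 => ?_, ?_⟩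
  · -- The averages pair with `1_V` to at least `c`, hence so does their limit.
    have hinner : Tendsto (fun N => inner ℝ
        (birkhoffAverage ℝ Q _root_.id N ((hmem 0).toLp _))
        (indicatorConstLp 2 hV hVf (1 : ℝ))) atTop
        (nhds (inner ℝ (ζ' : Lp ℝ 2 l) (indicatorConstLp 2 hV hVf (1 : ℝ)))) :=
      hlim.inner tendsto_const_nhds
    have hge : c ≤ inner ℝ (ζ' : Lp ℝ 2 l) (indicatorConstLp 2 hV hVf (1 : ℝ)) := by
      refine ge_of_tendsto hinner ?_
      filter_upwards [h, eventually_gt_atTop 0] with N hN hN0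
      have hN' : (0 : ℝ) < N := Nat.cast_pos.2 hN0
      rw [birkhoffAverage, birkhoffSum, real_inner_smul_left, sum_inner]
      have : ∀ n, inner ℝ (_root_.id (Q^[n] ((hmem 0).toLp _)))
          (indicatorConstLp 2 hV hVf (1 : ℝ)) = ∫ q in V, hittingProb p F S n q ∂l := by
        intro n
        rw [id, hiter, real_inner_comm, L2.inner_indicatorConstLp_one]
        exact setIntegral_congr_ae hV ((hmem n).coeFn_toLp.mono fun q hq _ => hq)
      simp_rw [this]
      rw [← div_eq_inv_mul, le_div_iff₀ hN']
      exact hN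
    rw [h0, inner_zero_left] at hge
    exact absurd hge (not_le.2 hc)
  · refine ae_comp_eq_of_inner_eq hF _ ?_
    change inner ℝ (T ζ') (J ζ') = _
    rw [← hQ, hfix, real_inner_self_eq_norm_sq]

end MeanErgodic

/-! ### Random compositions and essential boundedness -/

section EssentiallyBounded

open Measure
open scoped ENNReal Pointwise

/-- Under `p^ℕ` the first coordinate and the shifted sequence are independent. -/
lemma measurePreserving_natCons {Y : Type*} [MeasurableSpace Y] (p : Measure Y)
    [IsProbabilityMeasure p] :
    MeasurePreserving (fun t : Y × (ℕ → Y) => (fun n => Nat.casesOn n t.1 t.2 : ℕ → Y))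
      (p.prod (infinitePi fun _ : ℕ => p)) (infinitePi fun _ : ℕ => p) := by
  have hm : Measurable (fun t : Y × (ℕ → Y) => (fun n => Nat.casesOn n t.1 t.2 : ℕ → Y)) := by
    refine measurable_pi_lambda _ fun n => ?_
    cases n with
    | zero => exact measurable_fst
    | succ n => exact (measurable_pi_apply n).comp measurable_snd
  refine ⟨hm, eq_infinitePi _ fun s t ht => ?_⟩
  classical
  obtain ⟨N, hN⟩ : ∃ N, s ⊆ Finset.range (N + 1) :=
    ⟨s.sup id, fun i hi => Finset.mem_range.2 (Nat.lt_succ_of_le (Finset.le_sup (f := id) hi))⟩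
  -- Extend the box trivially to an initial segment of coordinates.
  let u : ℕ → Set Y := fun i => if i ∈ s then t i else Set.univ
  have hu : ∀ i, MeasurableSet (u i) := fun i => by
    by_cases hi : i ∈ s <;> simp [u, hi, ht]
  have hpre : (fun t : Y × (ℕ → Y) => (fun n => Nat.casesOn n t.1 t.2 : ℕ → Y)) ⁻¹' Set.pi s t =
      u 0 ×ˢ Set.pi (Finset.range N) fun i => u (i + 1) := by
    ext ⟨y, ω⟩
    simp only [Set.mem_preimage, Set.mem_pi, Set.mem_prod, Finset.mem_coe, Finset.mem_range]
    constructor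
    · intro h
      refine ⟨?_, fun i _ => ?_⟩
      · by_cases hi : 0 ∈ s
        · simpa [u, hi] using h 0 hi
        · simp [u, hi]
      · by_cases hi : i + 1 ∈ s
        · simpa [u, hi] using h (i + 1) hi
        · simp [u, hi]
    · rintro ⟨h0, h⟩ i hi
      cases i with
      | zero => simpa [u, hi] using h0
      | succ i =>
        have := Finset.mem_range.1 (hN hi)
        simpa [u, hi] using h i (by omega)
  have hprod : ∏ i ∈ s, p (t i) = ∏ i ∈ Finset.range (N + 1), p (u i) := by
    rw [← Finset.prod_subset hN (f := fun i => p (u i)) fun i _ hi => by simp [u, hi]]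
    exact Finset.prod_congr rfl fun i hi => by simp [u, hi]
  rw [map_apply hm (MeasurableSet.pi s.countable_toSet fun i _ => ht i), hpre, prod_prod,
    infinitePi_pi _ fun i _ => hu (i + 1), hprod, Finset.prod_range_succ', mul_comm]

/-- The non-negative coordinates of a `p^ℤ`-distributed sequence are `p^ℕ`-distributed. -/
lemma measurePreserving_restrict_nat {Y : Type*} [MeasurableSpace Y] (p : Measure Y)
    [IsProbabilityMeasure p] :
    MeasurePreserving (fun (ω : ℤ → Y) (n : ℕ) => ω n) (bernoulliMeasure p)
      (infinitePi fun _ : ℕ => p) := by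
  have hm : Measurable (fun (ω : ℤ → Y) (n : ℕ) => ω n) :=
    measurable_pi_lambda _ fun n => measurable_pi_apply _
  refine ⟨hm, eq_infinitePi _ fun s t ht => ?_⟩
  have hpre : (fun (ω : ℤ → Y) (n : ℕ) => ω n) ⁻¹' Set.pi s t =
      Set.pi (s.map Nat.castEmbedding : Finset ℤ) fun i => t i.toNat := by
    ext ω
    simp [Set.mem_pi]
  rw [map_apply hm (MeasurableSet.pi s.countable_toSet fun i _ => ht i), hpre, bernoulliMeasure,
    infinitePi_pi _ fun i _ => ht _]
  simp

/-- The random composition `F(ω_{n-1}, ·) ∘ ⋯ ∘ F(ω₀, ·)`. -/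
def randomIterate {Y Z : Type*} (F : Y × Z → Z) : ℕ → (ℕ → Y) → Z → Z
  | 0, _, q => q
  | n + 1, ω, q => randomIterate F n (fun k => ω (k + 1)) (F (ω 0, q))

lemma measurable_randomIterate {Y Z : Type*} [MeasurableSpace Y] [MeasurableSpace Z]
    {F : Y × Z → Z} (hF : Measurable F) (n : ℕ) :
    Measurable fun t : (ℕ → Y) × Z => randomIterate F n t.1 t.2 := by
  induction n with
  | zero => exact measurable_snd
  | succ n ih =>
    refine ih.comp (f := fun t : (ℕ → Y) × Z => (fun k => t.1 (k + 1), F (t.1 0, t.2)))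
      (Measurable.prodMk ?_ (hF.comp ?_))
    · exact measurable_pi_lambda _ fun k => (measurable_pi_apply _).comp measurable_fst
    · exact ((measurable_pi_apply _).comp measurable_fst).prodMk measurable_snd

lemma hittingProb_eq_measureReal {Y Z : Type*} [MeasurableSpace Y] [MeasurableSpace Z]
    {p : Measure Y} [IsProbabilityMeasure p] {F : Y × Z → Z} (hF : Measurable F) {S : Set Z}
    (hS : MeasurableSet S) (n : ℕ) (q : Z) :
    hittingProb p F S n q =
      (infinitePi fun _ : ℕ => p).real {ω | randomIterate F n ω q ∈ S} := by
  have hmeas : ∀ n, MeasurableSet {t : (ℕ → Y) × Z | randomIterate F n t.1 t.2 ∈ S} := fun n =>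
    measurable_randomIterate hF n hS
  induction n generalizing q with
  | zero =>
    by_cases h : q ∈ S <;> simp [hittingProb, randomIterate, h]
  | succ n ih =>
    have h1 : Measurable fun t : Y × (ℕ → Y) => (t.2, F (t.1, q)) :=
      measurable_snd.prodMk (hF.comp (measurable_fst.prodMk measurable_const))
    have h2 := h1 (hmeas n)
    have hslice : MeasurableSet {ω | randomIterate F (n + 1) ω q ∈ S} :=
      (measurable_id.prodMk measurable_const :
        Measurable fun ω : ℕ → Y => (ω, q)) (hmeas (n + 1))
    have h3 := (measurePreserving_natCons p).measure_preimage hslice.nullMeasurableSet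
    rw [measureReal_def, ← h3, ← measureReal_def]
    simp only [hittingProb, ih]
    rw [← integral_indicator_one
      (measurePreserving_natCons p |>.measurable hslice), integral_prod]
    · refine integral_congr_ae (Eventually.of_forall fun i => ?_)
      change _ = ∫ ω, Set.indicator {ω | randomIterate F n ω (F (i, q)) ∈ S} 1 ω ∂_
      rw [integral_indicator_one]
      exact measurable_prodMk_left (x := i) h2
    · exact (integrable_const (1 : ℝ)).indicator
        (measurePreserving_natCons p |>.measurable hslice)

lemma ncard_Iic_inter_eq_sum (D : Set ℕ) (n : ℕ) :
    ((Set.Iic n ∩ D).ncard : ℝ) =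
      ∑ k ∈ Finset.range (n + 1), D.indicator (fun _ => (1 : ℝ)) k := by
  classical
  have h : Set.Iic n ∩ D = ((Finset.range (n + 1)).filter (· ∈ D) : Finset ℕ) := by
    ext k
    simp
  rw [h, Set.ncard_coe_finset, Finset.card_filter]
  push_cast
  exact Finset.sum_congr rfl fun k _ => by simp [Set.indicator_apply]

/-- The sums over `[0, N)` and the division by `N`, in place of `[0, n]` and `n`, cost part of the
constant. -/
lemma eventually_le_sum_of_le_lowerAsymptoticDensity {D : Set ℕ} {δ : ℝ} (hδ : 0 < δ)
    (h : δ ≤ lowerAsymptoticDensity D) :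
    ∀ᶠ N : ℕ in atTop, δ / 4 * N ≤ ∑ k ∈ Finset.range N, D.indicator (fun _ => (1 : ℝ)) k := by
  have h1 : ∀ᶠ n : ℕ in atTop, δ / 2 < ((Set.Iic n ∩ D).ncard : ℝ) / n :=
    eventually_lt_of_lt_liminf (lt_of_lt_of_le (half_lt_self hδ) h)
      (isBoundedUnder_of_eventually_ge (a := 0) (Eventually.of_forall fun n => by positivity))
  obtain ⟨n₀, hn₀⟩ := eventually_atTop.1 h1
  filter_upwards [eventually_ge_atTop (n₀ + 2)] with N hN
  obtain ⟨n, rfl⟩ : ∃ n, N = n + 1 := ⟨N - 1, by omega⟩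
  have hn1 : (1 : ℝ) ≤ n := by exact_mod_cast (by omega : 1 ≤ n)
  have h2 := hn₀ n (by omega)
  rw [ncard_Iic_inter_eq_sum, lt_div_iff₀ (by linarith)] at h2
  push_cast
  nlinarith

lemma cocycleIter_succ_apply {S G : Type*} [Group G] (f : S → S) (A : S → G) (n : ℕ) (x : S) :
    cocycleIter f A (n + 1) x = cocycleIter f A n (f x) * A x := by
  induction n with
  | zero => simp [cocycleIter]
  | succ n ih =>
    rw [cocycleIter, ih, cocycleIter, mul_assoc, Function.iterate_succ_apply]

lemma measurable_cocycleIter {S G : Type*} [MeasurableSpace S] [Group G] [MeasurableSpace G]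
    [MeasurableMul₂ G] {f : S → S} (hf : Measurable f) {A : S → G} (hA : Measurable A) (n : ℕ) :
    Measurable (cocycleIter f A n) := by
  induction n with
  | zero => exact measurable_const
  | succ n ih => exact (hA.comp (hf.iterate n)).mul ih

variable {Y X G : Type*} [MeasurableSpace Y] [MeasurableSpace X]
  {p : Measure Y} [IsProbabilityMeasure p] {μ : Measure X}
  [Group G] [MeasurableSpace G]

namespace RandomCocycle

variable (f : RandomTransformation Y X) (A : RandomCocycle p μ G)

/-- The map `(i, q) ↦ F_i q` on `Y × (X × G)`. -/
def skewMap (t : Y × X × G) : X × G := A.skewProduct f t.1 t.2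

/-- The function `(ω, x) ↦ A_{ω₀}(x)`, which is almost everywhere equal to `A`. -/
def genFun (z : (ℤ → Y) × X) : G := A.gen (z.1 0) z.2

lemma randomIterate_skewMap (n : ℕ) (ω : ℤ → Y) (x : X) (g : G) :
    randomIterate (A.skewMap f) n (fun k => ω k) (x, g) =
      ((f.skew^[n] (ω, x)).2, cocycleIter f.skew A.genFun n (ω, x) * g) := by
  induction n generalizing ω x g with
  | zero => simp [randomIterate, cocycleIter]
  | succ n ih =>
    have h := ih (fun k => ω (k + 1)) (f.fiber (ω 0) x) (A.gen (ω 0) x * g)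
    rw [randomIterate, cocycleIter_succ_apply, Function.iterate_succ_apply, f.skew_apply,
      mul_assoc]
    simpa [skewMap, skewProduct, genFun] using h

omit [Group G] in
lemma measurable_genFun : Measurable A.genFun :=
  A.measurable_gen.comp (g := Function.uncurry A.gen)
    (f := fun z : (ℤ → Y) × X => (z.1 0, z.2))
    (((measurable_pi_apply 0).comp measurable_fst).prodMk measurable_snd)

lemma ae_cocycleIter_eq (hf : MeasurePreserving f.skew (barMeasure p μ) (barMeasure p μ)) :
    ∀ᵐ z ∂(barMeasure p μ), ∀ n,
      cocycleIter f.skew A.toFun n z = cocycleIter f.skew A.genFun n z := by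
  have h : ∀ᵐ z ∂(barMeasure p μ), ∀ n, A.toFun (f.skew^[n] z) = A.genFun (f.skew^[n] z) :=
    ae_all_iff.2 fun n => (hf.iterate n).quasiMeasurePreserving.ae A.ae_eq
  filter_upwards [h] with z hz n
  induction n with
  | zero => rfl
  | succ n ih => rw [cocycleIter, cocycleIter, ih, hz n]

variable [TopologicalSpace G] [IsTopologicalGroup G] [LocallyCompactSpace G]
  [T2Space G] [SecondCountableTopology G] [BorelSpace G] [IsProbabilityMeasure μ]

lemma IsEssentiallyBounded.exists_invariant
    (hf : MeasurePreserving f.skew (barMeasure p μ) (barMeasure p μ))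
    (h : A.IsEssentiallyBounded f) :
    ∃ ζ : Lp ℝ 2 (μ.prod (haar : Measure G)), ζ ≠ 0 ∧
      ∀ᵐ t ∂(p.prod (μ.prod (haar : Measure G))), ζ (A.skewMap f t) = ζ t.2 := by
  obtain ⟨K, δ, E, hK, hδ, -, hE0, hE⟩ := h
  obtain ⟨V, hVc, hV1⟩ := exists_compact_mem_nhds (1 : G)
  have hF : MeasurePreserving (A.skewMap f) (p.prod (μ.prod haar)) (μ.prod (haar : Measure G)) :=
    A.measurePreserving_skewProduct f hf
  have hVpos : 0 < (haar : Measure G).real V :=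
    ENNReal.toReal_pos (measure_pos_of_mem_nhds _ hV1).ne' hVc.measure_lt_top.ne
  have hcyl : ∀ C : Set G, IsCompact C → (μ.prod (haar : Measure G)) (Set.univ ×ˢ C) ≠ ∞ := by
    intro C hC
    rw [prod_prod, measure_univ, one_mul]
    exact hC.measure_lt_top.ne
  have hcylm : ∀ C : Set G, IsCompact C → MeasurableSet ((Set.univ : Set X) ×ˢ C) := fun C hC =>
    MeasurableSet.univ.prod hC.isClosed.measurableSet
  set D : ℕ → Set ((ℤ → Y) × X) := fun n => {z | cocycleIter f.skew A.genFun n z ∈ K} with hDdef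
  have hD : ∀ n, MeasurableSet (D n) := fun n =>
    measurable_cocycleIter f.skew.measurable A.measurable_genFun n hK.isClosed.measurableSet
  -- Starting in `univ ×ˢ V`, the walk is in `univ ×ˢ (K * V)` whenever `Aⁿ ∈ K`.
  have hhit : ∀ n, (haar : Measure G).real V * (barMeasure p μ).real (D n) ≤
      ∫ q in Set.univ ×ˢ V, hittingProb p (A.skewMap f) (Set.univ ×ˢ (K * V)) n q
        ∂(μ.prod (haar : Measure G)) := by
    intro n
    have hint := integrable_hittingProb hF (hcylm _ (hK.mul hVc)) (hcyl _ (hK.mul hVc)) n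
    have hsec : ∫ x, (bernoulliMeasure p).real {ω | (ω, x) ∈ D n} ∂μ =
        (barMeasure p μ).real (D n) := by
      rw [← integral_indicator_one (hD n), barMeasure, integral_prod_symm]
      · refine integral_congr_ae (Eventually.of_forall fun x => ?_)
        change _ = ∫ ω, Set.indicator {ω | (ω, x) ∈ D n} 1 ω ∂_
        rw [integral_indicator_one]
        exact measurable_prodMk_right (hD n)
      · exact (integrable_const (1 : ℝ)).indicator (hD n)
    have hrestr : (μ.prod (haar : Measure G)).restrict (Set.univ ×ˢ V) =
        μ.prod ((haar : Measure G).restrict V) := by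
      rw [← prod_restrict, restrict_univ]
    have : IsFiniteMeasure ((haar : Measure G).restrict V) :=
      ⟨by rw [restrict_apply_univ]; exact hVc.measure_lt_top⟩
    have hmeas : Measurable fun x => (bernoulliMeasure p).real {ω | (ω, x) ∈ D n} :=
      (measurable_measure_prodMk_right (hD n)).ennreal_toReal
    calc (haar : Measure G).real V * (barMeasure p μ).real (D n)
        = ∫ q in Set.univ ×ˢ V, (bernoulliMeasure p).real {ω | (ω, q.1) ∈ D n}
            ∂(μ.prod (haar : Measure G)) := by
          rw [hrestr, integral_fun_fst (fun x => (bernoulliMeasure p).real {ω | (ω, x) ∈ D n}),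
            hsec]
          simp
      _ ≤ _ := by
          refine setIntegral_mono_on ?_ hint.integrableOn (hcylm V hVc) ?_
          · rw [IntegrableOn, hrestr]
            refine Integrable.of_bound (hmeas.comp measurable_fst).aestronglyMeasurable 1
              (Eventually.of_forall fun q => ?_)
            rw [Real.norm_of_nonneg measureReal_nonneg]
            exact measureReal_le_one
          · rintro ⟨x, g⟩ ⟨-, hg⟩
            rw [hittingProb_eq_measureReal hF.measurable (hcylm _ (hK.mul hVc)),
              measureReal_def, measureReal_def,
              ← (measurePreserving_restrict_nat p).measure_preimage]
            · refine ENNReal.toReal_mono (measure_ne_top _ _) (measure_mono fun ω hω => ?_)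
              change randomIterate (A.skewMap f) n (fun k => ω k) (x, g) ∈
                (Set.univ : Set X) ×ˢ (K * V)
              rw [A.randomIterate_skewMap f]
              exact ⟨Set.mem_univ _, Set.mul_mem_mul hω hg⟩
            · exact (measurable_prodMk_right (measurable_randomIterate hF.measurable n
                (hcylm _ (hK.mul hVc)))).nullMeasurableSet
  -- On a set of positive measure the frequency of visits to `K` is bounded below uniformly.
  obtain ⟨N₀, hN₀⟩ : ∃ N₀ : ℕ, 0 < barMeasure p μ {z | z ∈ E ∧ ∀ N : ℕ, N₀ ≤ N →
      δ / 4 * N ≤ ∑ k ∈ Finset.range N,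
        {n | cocycleIter f.skew A.toFun n z ∈ K}.indicator (fun _ => (1 : ℝ)) k} := by
    refine exists_measure_pos_of_not_measure_iUnion_null (ne_of_gt (hE0.trans_le
      (measure_mono fun z hz => ?_)))
    obtain ⟨N₀, h⟩ := eventually_atTop.1
      (eventually_le_sum_of_le_lowerAsymptoticDensity hδ (hE z hz))
    exact Set.mem_iUnion.2 ⟨N₀, hz, h⟩
  set E' := {z | z ∈ E ∧ ∀ N : ℕ, N₀ ≤ N →
      δ / 4 * N ≤ ∑ k ∈ Finset.range N,
        {n | cocycleIter f.skew A.toFun n z ∈ K}.indicator (fun _ => (1 : ℝ)) k}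
  have hE'pos : 0 < (barMeasure p μ).real E' := ENNReal.toReal_pos hN₀.ne' (measure_ne_top _ _)
  have hsum : ∀ N : ℕ, N₀ ≤ N → δ / 4 * N * (barMeasure p μ).real E' ≤
      ∑ n ∈ Finset.range N, (barMeasure p μ).real (D n) := by
    intro N hN
    have hi : ∀ n, Integrable ((D n).indicator fun _ => (1 : ℝ)) (barMeasure p μ) := fun n =>
      (integrable_const (1 : ℝ)).indicator (hD n)
    have h1 : ∑ n ∈ Finset.range N, (barMeasure p μ).real (D n) =
        ∫ z, ∑ n ∈ Finset.range N, (D n).indicator (fun _ => (1 : ℝ)) z ∂(barMeasure p μ) := by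
      rw [integral_finsetSum _ fun n _ => hi n]
      refine Finset.sum_congr rfl fun n _ => ?_
      rw [integral_indicator (hD n)]
      simp
    rw [h1]
    refine le_trans ?_ (mul_meas_ge_le_integral_of_nonneg (Eventually.of_forall fun z => ?_)
      (integrable_finsetSum _ fun n _ => hi n) (δ / 4 * N))
    · refine mul_le_mul_of_nonneg_left ?_ (by positivity)
      refine ENNReal.toReal_mono (measure_ne_top _ _) (measure_mono_ae ?_)
      filter_upwards [A.ae_cocycleIter_eq f hf] with z hz hzE
      refine (hzE.2 N hN).trans (Finset.sum_le_sum fun n _ => le_of_eq ?_)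
      by_cases h : cocycleIter f.skew A.genFun n z ∈ K
      · rw [Set.indicator_of_mem (show z ∈ D n from h),
          Set.indicator_of_mem (by rw [Set.mem_ofPred_eq, hz n]; exact h)]
      · rw [Set.indicator_of_notMem (show z ∉ D n from h),
          Set.indicator_of_notMem (by rw [Set.mem_ofPred_eq, hz n]; exact h)]
    · exact Finset.sum_nonneg fun n _ => Set.indicator_nonneg (fun _ _ => zero_le_one) z
  refine exists_invariant_of_frequently_hitting hF (hcylm _ (hK.mul hVc)) (hcyl _ (hK.mul hVc))
    (hcylm V hVc) (hcyl V hVc)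
    (c := (haar : Measure G).real V * (δ / 4 * (barMeasure p μ).real E')) (by positivity) ?_
  filter_upwards [eventually_ge_atTop N₀] with N hN
  calc (haar : Measure G).real V * (δ / 4 * (barMeasure p μ).real E') * N
      = (haar : Measure G).real V * (δ / 4 * N * (barMeasure p μ).real E') := by ring
    _ ≤ (haar : Measure G).real V * ∑ n ∈ Finset.range N, (barMeasure p μ).real (D n) :=
        mul_le_mul_of_nonneg_left (hsum N hN) hVpos.le
    _ ≤ _ := by
        rw [Finset.mul_sum]
        exact Finset.sum_le_sum fun n _ => hhit n

end RandomCocycle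

end EssentiallyBounded

/-! ### Invariant vectors from stationary measures -/

section Stationary

open Measure
open scoped ENNReal

/-- The density of a stationary measure dominated by an invariant measure is an invariant
function. -/
lemma exists_invariant_of_stationary_le {Y Z : Type*} [MeasurableSpace Y] [MeasurableSpace Z]
    {p : Measure Y} [IsProbabilityMeasure p] {l : Measure Z} [SigmaFinite l] {F : Y × Z → Z}
    (hF : MeasurePreserving F (p.prod l) l) {ρ : Measure Z} [IsFiniteMeasure ρ] (hρ : ρ ≠ 0)
    (hle : ρ ≤ l) (hFρ : MeasurePreserving F (p.prod ρ) ρ) :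
    ∃ ζ : Lp ℝ 2 l, ζ ≠ 0 ∧ ∀ᵐ t ∂(p.prod l), ζ (F t) = ζ t.2 := by
  have hac : ρ ≪ l := absolutelyContinuous_of_le hle
  set r := ρ.rnDeriv l
  have hr : Measurable r := measurable_rnDeriv ρ l
  have hr1 : ∀ᵐ q ∂l, r q ≤ 1 := rnDeriv_le_one_of_le hle
  have hmem : MemLp (fun q => (r q).toReal) 2 l := by
    refine memLp_two_of_integrable_of_mem_Icc integrable_toReal_rnDeriv ?_
    filter_upwards [hr1] with q hq
    exact ⟨ENNReal.toReal_nonneg, by simpa using ENNReal.toReal_mono ENNReal.one_ne_top hq⟩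
  have hcoe := hmem.coeFn_toLp
  have hF1 : ∀ᵐ t ∂(p.prod l), r (F t) ≤ 1 := hF.quasiMeasurePreserving.ae hr1
  have hsnd : MeasurePreserving (Prod.snd : Y × Z → Z) (p.prod l) l := measurePreserving_snd
  have hs1 : ∀ᵐ t ∂(p.prod l), r t.2 ≤ 1 := hsnd.quasiMeasurePreserving.ae hr1
  have hmul : ∀ {ψ : Z → ℝ≥0∞}, Measurable ψ → ∫⁻ q, r q * ψ q ∂l = ∫⁻ q, ψ q ∂ρ :=
    fun hψ => lintegral_rnDeriv_mul hac hψ.aemeasurable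
  -- Both sides below equal `∫ r dρ`.
  have hkey : ∫⁻ t, r (F t) * r t.2 ∂(p.prod l) = ∫⁻ q, r q * r q ∂l := by
    rw [hmul hr, ← hFρ.lintegral_comp hr,
      lintegral_prod (fun t => r (F t) * r t.2)
        ((hr.comp hF.measurable).mul (hr.comp measurable_snd)).aemeasurable,
      lintegral_prod (fun t => r (F t)) (hr.comp hF.measurable).aemeasurable]
    refine lintegral_congr fun i => ?_
    exact (lintegral_congr fun q => mul_comm _ _).trans
      (hmul (ψ := fun q => r (F (i, q))) ((hr.comp hF.measurable).comp measurable_prodMk_left))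
  refine ⟨hmem.toLp _, fun h0 => hρ ?_, ae_comp_eq_of_inner_eq hF _ ?_⟩
  · have h1 : r =ᵐ[l] 0 := by
      have h2 : (fun q => (r q).toReal) =ᵐ[l] 0 :=
        hcoe.symm.trans (by rw [h0]; exact Lp.coeFn_zero _ _ _)
      filter_upwards [h2, hr1] with q hq hq1
      rcases (ENNReal.toReal_eq_zero_iff _).1 hq with h | h
      · exact h
      · rw [h] at hq1
        exact absurd hq1 (by simp)
    rw [← withDensity_rnDeriv_eq ρ l hac, withDensity_congr_ae h1, withDensity_zero]
  · rw [← real_inner_self_eq_norm_sq, L2.inner_def, L2.inner_def]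
    have h1 : (fun t => inner ℝ
        ((Lp.compMeasurePreservingₗᵢ (E := ℝ) (p := 2) ℝ F hF) (hmem.toLp _) t)
        ((Lp.compMeasurePreservingₗᵢ (E := ℝ) (p := 2) ℝ Prod.snd hsnd) (hmem.toLp _) t))
        =ᵐ[p.prod l] fun t => (r (F t) * r t.2).toReal := by
      filter_upwards [Lp.coeFn_compMeasurePreserving (hmem.toLp _) hF,
        Lp.coeFn_compMeasurePreserving (hmem.toLp _) hsnd, hF.quasiMeasurePreserving.ae hcoe,
        hsnd.quasiMeasurePreserving.ae hcoe] with t h2 h3 h4 h5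
      have h6 : (Lp.compMeasurePreservingₗᵢ (E := ℝ) (p := 2) ℝ F hF) (hmem.toLp _) t =
          (r (F t)).toReal := h2.trans h4
      have h7 : (Lp.compMeasurePreservingₗᵢ (E := ℝ) (p := 2) ℝ Prod.snd hsnd) (hmem.toLp _) t =
          (r t.2).toReal := h3.trans h5
      rw [h6, h7, ENNReal.toReal_mul]
      simp [mul_comm]
    have h8 : (fun q => inner ℝ (hmem.toLp _ q) (hmem.toLp _ q)) =ᵐ[l]
        fun q => (r q * r q).toReal := by
      filter_upwards [hcoe] with q hq
      rw [hq, ENNReal.toReal_mul]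
      simp [pow_two]
    rw [integral_congr_ae h1, integral_congr_ae h8, integral_toReal, integral_toReal, hkey]
    · exact (hr.mul hr).aemeasurable
    · filter_upwards [hr1] with q hq
      exact ENNReal.mul_lt_top (hq.trans_lt ENNReal.one_lt_top) (hq.trans_lt ENNReal.one_lt_top)
    · exact ((hr.comp hF.measurable).mul (hr.comp measurable_snd)).aemeasurable
    · filter_upwards [hF1, hs1] with t h2 h3
      exact ENNReal.mul_lt_top (h2.trans_lt ENNReal.one_lt_top) (h3.trans_lt ENNReal.one_lt_top)

variable {Y X G : Type*} [MeasurableSpace Y] [MeasurableSpace X]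
  {p : Measure Y} [IsProbabilityMeasure p] {μ : Measure X}
  [Group G] [MeasurableSpace G]

namespace RandomCocycle

variable (f : RandomTransformation Y X) (A : RandomCocycle p μ G)

lemma isStationary_iff_measurePreserving [MeasurableMul₂ G] (m : Measure (X × G)) [SFinite m] :
    A.IsStationary f m ↔
      m.map Prod.fst = μ ∧ MeasurePreserving (A.skewMap f) (p.prod m) m := by
  have hF : Measurable (A.skewMap f) := A.measurable_skewProduct_uncurry f
  have hmap : ∀ E, MeasurableSet E →
      (p.prod m).map (A.skewMap f) E = ∫⁻ i, (m.map (A.skewProduct f i)) E ∂p := by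
    intro E hE
    rw [map_apply hF hE, prod_apply (hF hE)]
    refine lintegral_congr fun i => ?_
    rw [map_apply (A.measurable_skewProduct f i) hE]
    rfl
  refine and_congr_right fun _ => ⟨fun h => ⟨hF, ?_⟩, fun h E hE => ?_⟩
  · ext E hE
    rw [hmap E hE, h E hE]
  · rw [← hmap E hE, h.map_eq]

variable [TopologicalSpace G] [IsTopologicalGroup G] [LocallyCompactSpace G]
  [SecondCountableTopology G] [BorelSpace G] [IsProbabilityMeasure μ]

/-- Convolving a stationary measure on the right with the indicator of a compact neighbourhood of
the identity gives a stationary measure that is dominated by `μ × haar`. -/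
lemma IsStationary.exists_invariant
    (hf : MeasurePreserving f.skew (barMeasure p μ) (barMeasure p μ))
    {m : Measure (X × G)} [IsProbabilityMeasure m] (h : A.IsStationary f m) :
    ∃ ζ : Lp ℝ 2 (μ.prod (haar : Measure G)), ζ ≠ 0 ∧
      ∀ᵐ t ∂(p.prod (μ.prod (haar : Measure G))), ζ (A.skewMap f t) = ζ t.2 := by
  obtain ⟨hfst, hFm⟩ := (A.isStationary_iff_measurePreserving f m).1 h
  obtain ⟨V, hVc, hV1⟩ := exists_compact_mem_nhds (1 : G)
  have hF : MeasurePreserving (A.skewMap f) (p.prod (μ.prod haar)) (μ.prod (haar : Measure G)) :=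
    A.measurePreserving_skewProduct f hf
  set ν := (haar : Measure G).restrict V
  have hν : IsFiniteMeasure ν := ⟨by rw [restrict_apply_univ]; exact hVc.measure_lt_top⟩
  have hR : Measurable fun t : (X × G) × G => (t.1.1, t.1.2 * t.2) :=
    (measurable_fst.comp measurable_fst).prodMk
      ((measurable_snd.comp measurable_fst).mul measurable_snd)
  set ρ := (m.prod ν).map fun t : (X × G) × G => (t.1.1, t.1.2 * t.2)
  have hρ : ∀ ψ : X × G → ℝ≥0∞, Measurable ψ →
      ∫⁻ q, ψ q ∂ρ = ∫⁻ q, ∫⁻ g, ψ (q.1, q.2 * g) ∂ν ∂m := by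
    intro ψ hψ
    rw [lintegral_map hψ hR]
    exact lintegral_prod _ (hψ.comp hR).aemeasurable
  have hρ0 : ρ ≠ 0 := by
    intro h0
    have h1 : ρ Set.univ = ν Set.univ := by
      rw [map_apply hR MeasurableSet.univ, Set.preimage_univ, ← Set.univ_prod_univ, prod_prod,
        measure_univ, one_mul]
    rw [h0, restrict_apply_univ] at h1
    exact (measure_pos_of_mem_nhds (haar : Measure G) hV1).ne h1
  have hle : ρ ≤ μ.prod haar := by
    refine le_intro fun S hS _ => ?_
    have hi : Measurable (S.indicator fun _ => (1 : ℝ≥0∞)) := measurable_const.indicator hS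
    have hx : Measurable fun x : X => ∫⁻ g, S.indicator (fun _ => (1 : ℝ≥0∞)) (x, g) ∂haar :=
      hi.lintegral_prod_right'
    rw [← lintegral_indicator_one hS, ← lintegral_indicator_one hS]
    calc ∫⁻ q, S.indicator (fun _ => (1 : ℝ≥0∞)) q ∂ρ
        = ∫⁻ q, ∫⁻ g, S.indicator (fun _ => (1 : ℝ≥0∞)) (q.1, q.2 * g) ∂ν ∂m := hρ _ hi
      _ ≤ ∫⁻ q, ∫⁻ g, S.indicator (fun _ => (1 : ℝ≥0∞)) (q.1, q.2 * g) ∂haar ∂m :=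
          lintegral_mono fun q => lintegral_mono' restrict_le_self le_rfl
      _ = ∫⁻ q, ∫⁻ g, S.indicator (fun _ => (1 : ℝ≥0∞)) (q.1, g) ∂haar ∂m :=
          lintegral_congr fun q => lintegral_mul_left_eq_self
            (fun g => S.indicator (fun _ => (1 : ℝ≥0∞)) (q.1, g)) q.2
      _ = ∫⁻ x, ∫⁻ g, S.indicator (fun _ => (1 : ℝ≥0∞)) (x, g) ∂haar ∂μ := by
          rw [← hfst, lintegral_map hx measurable_fst]
      _ = _ := (lintegral_prod _ hi.aemeasurable).symm
  have hFρ : MeasurePreserving (A.skewMap f) (p.prod ρ) ρ := by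
    refine ⟨hF.measurable, Measure.ext_of_lintegral _ fun ψ hψ => ?_⟩
    have hΦ : Measurable fun q : X × G => ∫⁻ g, ψ (q.1, q.2 * g) ∂ν :=
      (hψ.comp hR).lintegral_prod_right'
    rw [lintegral_map hψ hF.measurable, hρ ψ hψ, ← hFm.lintegral_comp hΦ,
      lintegral_prod (fun t => ψ (A.skewMap f t)) (hψ.comp hF.measurable).aemeasurable,
      lintegral_prod (fun t => ∫⁻ g, ψ ((A.skewMap f t).1, (A.skewMap f t).2 * g) ∂ν)
        (hΦ.comp hF.measurable).aemeasurable]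
    refine lintegral_congr fun i => ?_
    rw [hρ (fun q => ψ (A.skewMap f (i, q)))
      ((hψ.comp hF.measurable).comp measurable_prodMk_left)]
    refine lintegral_congr fun q => lintegral_congr fun g => ?_
    simp [skewMap, skewProduct, mul_assoc]
  exact exists_invariant_of_stationary_le hF hρ0 hle hFρ

end RandomCocycle

end Stationary

/-! ### From invariant vectors to compact subgroups -/

section Reduction

open Measure
open scoped ENNReal

variable {Y X G : Type*} [MeasurableSpace Y] [MeasurableSpace X]
  {p : Measure Y} [IsProbabilityMeasure p] {μ : Measure X} [IsProbabilityMeasure μ]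
  [Group G] [TopologicalSpace G] [IsTopologicalGroup G] [LocallyCompactSpace G]
  [SecondCountableTopology G] [MeasurableSpace G] [BorelSpace G]

namespace RandomCocycle

variable (f : RandomTransformation Y X) (A : RandomCocycle p μ G)

/-- A nonzero invariant function on `X × G`, seen as a function `ξ` on `X` with values in
`L²(G)`, is equivariant and almost nowhere zero. -/
lemma exists_equivariant_of_invariant (hf : Ergodic f.skew (barMeasure p μ))
    [MeasurableSpace (Lp ℝ 2 (haar : Measure G))] [BorelSpace (Lp ℝ 2 (haar : Measure G))]
    {ζ : Lp ℝ 2 (μ.prod (haar : Measure G))} (hζ : ζ ≠ 0)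
    (hinv : ∀ᵐ t ∂(p.prod (μ.prod (haar : Measure G))), ζ (A.skewMap f t) = ζ t.2) :
    ∃ ξ : X → Lp ℝ 2 (haar : Measure G), Measurable ξ ∧ (∀ᵐ x ∂μ, ξ x ≠ 0) ∧
      ∀ᵐ q ∂(p.prod μ), ξ (f.fiber q.1 q.2) = leftTranslate (A.gen q.1 q.2) (ξ q.2) := by
  have hfib := f.measurePreserving_fiber hf.toMeasurePreserving
  have hsnd : MeasurePreserving (Prod.snd : Y × X → X) (p.prod μ) μ := measurePreserving_snd
  have hζm := (Lp.stronglyMeasurable ζ).measurable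
  obtain ⟨ξ, hξ, hξζ⟩ := exists_measurable_fibre hζm (Lp.memLp ζ)
  have hequi : ∀ᵐ q ∂(p.prod μ),
      ξ (f.fiber q.1 q.2) = leftTranslate (A.gen q.1 q.2) (ξ q.2) := by
    have h1 := (measurePreserving_prodAssoc p μ (haar : Measure G)).quasiMeasurePreserving.ae hinv
    filter_upwards [ae_ae_of_ae_prod h1, hfib.quasiMeasurePreserving.ae hξζ,
      hsnd.quasiMeasurePreserving.ae hξζ] with q h2 h3 h4
    refine eq_leftTranslate_of_ae_eq ?_
    filter_upwards [h2, (measurePreserving_mul_left (haar : Measure G)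
      (A.gen q.1 q.2)).quasiMeasurePreserving.ae h3, h4] with g h5 h6 h7
    exact h6.trans (h5.trans h7.symm)
  refine ⟨ξ, hξ, ?_, hequi⟩
  obtain ⟨c, hc⟩ := f.ae_eq_const_of_fiber_invariant hf (u := fun x => ‖ξ x‖) hξ.norm (by
    filter_upwards [hequi] with q hq
    rw [hq, norm_leftTranslate])
  have hc0 : c ≠ 0 := by
    rintro rfl
    refine hζ (Lp.ext ?_)
    have h2 : ∀ᵐ q ∂(μ.prod (haar : Measure G)), ζ q = 0 := by
      refine (ae_prod_iff_ae_ae (measurableSet_eq_fun hζm measurable_const)).2 ?_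
      filter_upwards [hc, hξζ] with x h3 h4
      rw [norm_eq_zero.1 h3] at h4
      filter_upwards [h4, Lp.coeFn_zero ℝ 2 (haar : Measure G)] with g h5 h6
      rw [← h5, h6, Pi.zero_apply]
    filter_upwards [h2, Lp.coeFn_zero ℝ 2 (μ.prod (haar : Measure G))] with q h5 h6
    rw [h5, h6, Pi.zero_apply]
  filter_upwards [hc] with x hx h0
  rw [h0, norm_zero] at hx
  exact hc0 hx.symm

/-- An equivariant function takes almost all of its values in a single orbit: if `ξ₀` is in the
support of its distribution, the invariant function `dist (ξ x, G ξ₀)` is arbitrarily small with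
positive probability. -/
lemma exists_ae_mem_orbit_of_equivariant [T2Space G] (hf : Ergodic f.skew (barMeasure p μ))
    [MeasurableSpace (Lp ℝ 2 (haar : Measure G))] [BorelSpace (Lp ℝ 2 (haar : Measure G))]
    {ξ : X → Lp ℝ 2 (haar : Measure G)} (hξ : Measurable ξ) (hξ0 : ∀ᵐ x ∂μ, ξ x ≠ 0)
    (hequi : ∀ᵐ q ∂(p.prod μ), ξ (f.fiber q.1 q.2) = leftTranslate (A.gen q.1 q.2) (ξ q.2)) :
    ∃ ξ₀ : Lp ℝ 2 (haar : Measure G), ξ₀ ≠ 0 ∧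
      ∀ᵐ x ∂μ, ξ x ∈ Set.range fun g : G => leftTranslate g ξ₀ := by
  have : Fact ((2 : ℝ≥0∞) ≠ ∞) := ⟨by simp⟩
  have hsupp : ∀ᵐ x ∂μ, ξ x ∈ (μ.map ξ).support :=
    ae_of_ae_map hξ.aemeasurable support_mem_ae
  obtain ⟨x₀, hx₀, hx₀'⟩ := (hsupp.and hξ0).exists
  set O := Set.range fun g : G => leftTranslate g (ξ x₀)
  have hmemO : ξ x₀ ∈ O := ⟨1, leftTranslate_one _⟩
  refine ⟨ξ x₀, hx₀', ?_⟩
  obtain ⟨c, hc⟩ := f.ae_eq_const_of_fiber_invariant hf (u := fun x => Metric.infDist (ξ x) O)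
    ((Metric.continuous_infDist_pt O).measurable.comp hξ) (by
      filter_upwards [hequi] with q hq
      rw [hq, infDist_leftTranslate])
  have hc0 : c = 0 := by
    by_contra hne
    have hcpos : 0 < c := by
      obtain ⟨x, hx⟩ := hc.exists
      exact lt_of_le_of_ne (hx ▸ Metric.infDist_nonneg) (Ne.symm hne)
    have hU : IsOpen {w | Metric.infDist w O < c} :=
      isOpen_lt (Metric.continuous_infDist_pt O) continuous_const
    have hpos := (mem_support_iff_forall _).1 hx₀ _
      (hU.mem_nhds (show Metric.infDist (ξ x₀) O < c by
        rwa [Metric.infDist_zero_of_mem hmemO]))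
    rw [map_apply hξ hU.measurableSet] at hpos
    refine hpos.ne' (measure_eq_zero_iff_ae_notMem.2 ?_)
    filter_upwards [hc] with x hx h
    exact absurd (show Metric.infDist (ξ x) O < c from h) (by rw [hx]; exact lt_irrefl c)
  filter_upwards [hc, hξ0] with x hx hx0
  refine mem_range_leftTranslate_of_mem_closure hx0 ?_
  rw [Metric.mem_closure_iff_infDist_zero (Set.range_nonempty _), hx, hc0]

omit [LocallyCompactSpace G] in
/-- If `P(f_i x)⁻¹ A_i(x) P(x)` is in a closed subgroup `H` for almost every `(i, x)`, then `A` is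
cohomologous to a random cocycle with all values in `H`: the values outside of `H` are replaced
by the identity. -/
lemma exists_isCohomologous_of_ae_mem {H : Subgroup G} (hH : IsClosed (H : Set G)) {P : X → G}
    (hP : Measurable P)
    (h : ∀ᵐ q ∂(p.prod μ), (P (f.fiber q.1 q.2))⁻¹ * A.gen q.1 q.2 * P q.2 ∈ H) :
    ∃ B : RandomCocycle p μ G, (∀ z, B.toFun z ∈ H) ∧ A.IsCohomologous f B := by
  classical
  let b : Y × X → G := fun q => (P (f.fiber q.1 q.2))⁻¹ * A.gen q.1 q.2 * P q.2
  have hb : Measurable b :=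
    ((hP.comp f.measurable_fiber).inv.mul A.measurable_gen).mul (hP.comp measurable_snd)
  let b' : Y × X → G := fun q => if b q ∈ (H : Set G) then b q else 1
  have hb' : Measurable b' := Measurable.ite (hb hH.measurableSet) hb measurable_const
  have hz : Measurable fun z : (ℤ → Y) × X => (z.1 0, z.2) :=
    ((measurable_pi_apply 0).comp measurable_fst).prodMk measurable_snd
  refine ⟨⟨fun z => b' (z.1 0, z.2), hb'.comp hz, fun i x => b' (i, x), hb',
    Eventually.of_forall fun z => rfl⟩, fun z => ?_, P, hP, ?_⟩
  · by_cases hm : b (z.1 0, z.2) ∈ (H : Set G)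
    · change b' (z.1 0, z.2) ∈ H
      simp only [b']
      rw [if_pos hm]
      exact hm
    · change b' (z.1 0, z.2) ∈ H
      simp only [b']
      rw [if_neg hm]
      exact H.one_mem
  · filter_upwards [ae_barMeasure_of_ae h, A.ae_eq] with z h1 h2
    rw [h2]
    exact if_pos h1

/-- The conjugating function `P` is a Borel section of the orbit map of `ξ₀`, composed with the
equivariant function. -/
lemma exists_compact_reduction_of_invariant [T2Space G] (hf : Ergodic f.skew (barMeasure p μ))
    {ζ : Lp ℝ 2 (μ.prod (haar : Measure G))} (hζ : ζ ≠ 0)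
    (hinv : ∀ᵐ t ∂(p.prod (μ.prod (haar : Measure G))), ζ (A.skewMap f t) = ζ t.2) :
    ∃ (H : Subgroup G) (B : RandomCocycle p μ G), IsCompact (H : Set G) ∧
        (∀ z, B.toFun z ∈ H) ∧ A.IsCohomologous f B := by
  borelize ↥(Lp ℝ 2 (haar : Measure G))
  have hfib := f.measurePreserving_fiber hf.toMeasurePreserving
  have hsnd : MeasurePreserving (Prod.snd : Y × X → X) (p.prod μ) μ := measurePreserving_snd
  obtain ⟨ξ, hξ, hξ0, hequi⟩ := A.exists_equivariant_of_invariant f hf hζ hinv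
  obtain ⟨ξ₀, hξ₀, horb⟩ := A.exists_ae_mem_orbit_of_equivariant f hf hξ hξ0 hequi
  obtain ⟨s, hs, hsec⟩ := exists_measurable_section (continuous_leftTranslate ξ₀)
  have hP : ∀ᵐ x ∂μ, leftTranslate (s (ξ x)) ξ₀ = ξ x := horb.mono fun x hx => hsec _ hx
  have hcpt := isCompact_translationStabilizer hξ₀
  obtain ⟨B, hB, hAB⟩ := A.exists_isCohomologous_of_ae_mem f hcpt.isClosed (hs.comp hξ) (by
    filter_upwards [hequi, hfib.quasiMeasurePreserving.ae hP, hsnd.quasiMeasurePreserving.ae hP]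
      with q h1 h2 h3
    rw [mem_translationStabilizer, leftTranslate_mul, leftTranslate_mul]
    change leftTranslate _ (leftTranslate _ (leftTranslate (s (ξ q.2)) ξ₀)) = ξ₀
    rw [h3, ← h1, ← h2, ← leftTranslate_mul]
    simp [leftTranslate_one])
  exact ⟨_, B, hcpt, hB, hAB⟩

end RandomCocycle

end Reduction

/-! ### Cocycles that are cohomologous to compact ones -/

section Converse

open Measure
open scoped ENNReal Pointwise

lemma le_lowerAsymptoticDensity {D : Set ℕ} {δ : ℝ}
    (h : ∀ n : ℕ, δ * n ≤ ∑ k ∈ Finset.range n, D.indicator (fun _ => (1 : ℝ)) k) (hδ : 0 ≤ δ) :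
    δ ≤ lowerAsymptoticDensity D := by
  refine le_liminf_of_le (isCoboundedUnder_ge_of_le atTop (x := 2) fun n => ?_) ?_
  · rcases Nat.eq_zero_or_pos n with rfl | hn
    · simp
    · have hn' : (1 : ℝ) ≤ n := by exact_mod_cast hn
      rw [div_le_iff₀ (by linarith), ncard_Iic_inter_eq_sum]
      calc ∑ k ∈ Finset.range (n + 1), D.indicator (fun _ => (1 : ℝ)) k
          ≤ ∑ k ∈ Finset.range (n + 1), (1 : ℝ) :=
            Finset.sum_le_sum fun k _ => Set.indicator_le_self' (fun _ _ => zero_le_one) k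
        _ = n + 1 := by simp
        _ ≤ 2 * n := by linarith
  · filter_upwards [eventually_gt_atTop 0] with n hn
    rw [le_div_iff₀ (Nat.cast_pos.2 hn), ncard_Iic_inter_eq_sum]
    have h1 := h (n + 1)
    push_cast at h1
    nlinarith

/-- A compact subgroup carries an invariant probability measure, its Haar measure. -/
lemma Subgroup.exists_isProbabilityMeasure_invariant {G : Type*} [Group G] [TopologicalSpace G]
    [IsTopologicalGroup G] [MeasurableSpace G] [BorelSpace G] {H : Subgroup G}
    (hH : IsCompact (H : Set G)) :
    ∃ ν : Measure G, IsProbabilityMeasure ν ∧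
      ∀ b ∈ H, ∀ ψ : G → ℝ≥0∞, Measurable ψ → ∫⁻ h, ψ (b * h) ∂ν = ∫⁻ h, ψ h ∂ν := by
  have : CompactSpace H := isCompact_iff_compactSpace.1 hH
  have hprob : IsProbabilityMeasure (haarMeasure (⊤ : TopologicalSpace.PositiveCompacts H)) :=
    ⟨haarMeasure_self⟩
  have hval : Measurable (Subtype.val : H → G) := measurable_subtype_coe
  refine ⟨(haarMeasure (⊤ : TopologicalSpace.PositiveCompacts H)).map Subtype.val,
    isProbabilityMeasure_map hval.aemeasurable, fun b hb ψ hψ => ?_⟩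
  have hmul : Measurable fun h : G => b * h := (continuous_const_mul b).measurable
  rw [lintegral_map (f := fun h => ψ (b * h)) (hψ.comp hmul) hval, lintegral_map hψ hval]
  exact lintegral_mul_left_eq_self (fun h : H => ψ h) (⟨b, hb⟩ : H)

variable {Y X G : Type*} [MeasurableSpace Y] [MeasurableSpace X]
  {p : Measure Y} [IsProbabilityMeasure p] {μ : Measure X} [IsProbabilityMeasure μ]
  [Group G] [TopologicalSpace G] [IsTopologicalGroup G]
  [T2Space G] [SecondCountableTopology G] [MeasurableSpace G] [BorelSpace G]

namespace RandomCocycle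

variable (f : RandomTransformation Y X) (A : RandomCocycle p μ G)

/-- The stationary measure is the image of `μ × haar_H` under `(x, h) ↦ (x, P(x) h)`. -/
lemma exists_isStationary_of_compact_reduction
    (hf : MeasurePreserving f.skew (barMeasure p μ) (barMeasure p μ))
    {H : Subgroup G} {B : RandomCocycle p μ G} (hH : IsCompact (H : Set G))
    (hB : ∀ z, B.toFun z ∈ H) (hAB : A.IsCohomologous f B) :
    ∃ m : Measure (X × G), IsProbabilityMeasure m ∧ A.IsStationary f m := by
  obtain ⟨P, hP, hPB⟩ := hAB
  have hfib := f.measurePreserving_fiber hf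
  have hbm : Measurable fun q : Y × X =>
      (P (f.fiber q.1 q.2))⁻¹ * A.gen q.1 q.2 * P q.2 :=
    ((hP.comp f.measurable_fiber).inv.mul A.measurable_gen).mul (hP.comp measurable_snd)
  have hb : ∀ᵐ q ∂(p.prod μ), (P (f.fiber q.1 q.2))⁻¹ * A.gen q.1 q.2 * P q.2 ∈ H := by
    refine (ae_barMeasure_iff (hbm hH.isClosed.measurableSet)).1 ?_
    filter_upwards [hPB, A.ae_eq] with z h1 h2
    rw [← h2, ← h1]
    exact hB z
  obtain ⟨ν, hν, hνinv⟩ := H.exists_isProbabilityMeasure_invariant hH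
  have hR : Measurable fun q : X × G => (q.1, P q.1 * q.2) :=
    measurable_fst.prodMk ((hP.comp measurable_fst).mul measurable_snd)
  set m := (μ.prod ν).map fun q : X × G => (q.1, P q.1 * q.2)
  have hm : IsProbabilityMeasure m := isProbabilityMeasure_map hR.aemeasurable
  have hmψ : ∀ ψ : X × G → ℝ≥0∞, Measurable ψ →
      ∫⁻ q, ψ q ∂m = ∫⁻ x, ∫⁻ h, ψ (x, P x * h) ∂ν ∂μ := by
    intro ψ hψ
    rw [lintegral_map hψ hR]
    exact lintegral_prod _ (hψ.comp hR).aemeasurable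
  have hF : Measurable (A.skewMap f) := A.measurable_skewProduct_uncurry f
  refine ⟨m, hm, (A.isStationary_iff_measurePreserving f m).2 ⟨?_, hF, ?_⟩⟩
  · rw [map_map measurable_fst hR]
    exact map_fst_prod.trans (by simp)
  refine Measure.ext_of_lintegral _ fun ψ hψ => ?_
  have hΦ : Measurable fun x : X => ∫⁻ h, ψ (x, P x * h) ∂ν :=
    (hψ.comp hR).lintegral_prod_right'
  have hT : Measurable fun t : (Y × X) × G =>
      ψ (f.fiber t.1.1 t.1.2, A.gen t.1.1 t.1.2 * (P t.1.2 * t.2)) := by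
    refine hψ.comp ((f.measurable_fiber.comp measurable_fst).prodMk ?_)
    exact (A.measurable_gen.comp measurable_fst).mul
      ((hP.comp (measurable_snd.comp measurable_fst)).mul measurable_snd)
  calc ∫⁻ q, ψ q ∂((p.prod m).map (A.skewMap f))
      = ∫⁻ i, ∫⁻ q, ψ (A.skewMap f (i, q)) ∂m ∂p := by
        rw [lintegral_map hψ hF]
        exact lintegral_prod _ (hψ.comp hF).aemeasurable
    _ = ∫⁻ i, ∫⁻ x, ∫⁻ h, ψ (f.fiber i x, A.gen i x * (P x * h)) ∂ν ∂μ ∂p :=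
        lintegral_congr fun i => hmψ (fun q => ψ (A.skewMap f (i, q)))
          ((hψ.comp hF).comp measurable_prodMk_left)
    _ = ∫⁻ q, ∫⁻ h, ψ (f.fiber q.1 q.2, A.gen q.1 q.2 * (P q.2 * h)) ∂ν ∂(p.prod μ) :=
        (lintegral_prod _ hT.lintegral_prod_right'.aemeasurable).symm
    _ = ∫⁻ q, ∫⁻ h, ψ (f.fiber q.1 q.2, P (f.fiber q.1 q.2) * h) ∂ν ∂(p.prod μ) := by
        refine lintegral_congr_ae ?_
        filter_upwards [hb] with q hq
        rw [← hνinv _ hq (fun h => ψ (f.fiber q.1 q.2, P (f.fiber q.1 q.2) * h))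
          (hψ.comp (measurable_const.prodMk (measurable_const.mul measurable_id)))]
        refine lintegral_congr fun h => ?_
        congr 2
        group
    _ = ∫⁻ x, ∫⁻ h, ψ (x, P x * h) ∂ν ∂μ := hfib.lintegral_comp hΦ
    _ = ∫⁻ q, ψ q ∂m := (hmψ ψ hψ).symm

/-- `Aⁿ(z) ∈ P(x_n) H P(x)⁻¹`, where `x_n` is the position at time `n`; so `Aⁿ(z)` is in a fixed
compact set whenever `P(x_n)` is, and by the maximal ergodic lemma this happens with positive
frequency. -/
lemma isEssentiallyBounded_of_compact_reduction [LocallyCompactSpace G]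
    (hf : MeasurePreserving f.skew (barMeasure p μ) (barMeasure p μ))
    {H : Subgroup G} {B : RandomCocycle p μ G} (hH : IsCompact (H : Set G))
    (hB : ∀ z, B.toFun z ∈ H) (hAB : A.IsCohomologous f B) :
    A.IsEssentiallyBounded f := by
  obtain ⟨P, hP, hPB⟩ := hAB
  have hPz : Measurable fun z : (ℤ → Y) × X => P z.2 := hP.comp measurable_snd
  let W : ℕ → Set ((ℤ → Y) × X) := fun n =>
    {z | (P (f.skew^[n] z).2)⁻¹ * cocycleIter f.skew A.toFun n z * P z.2 ∈ H}
  have hWm : ∀ n, MeasurableSet (W n) := fun n =>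
    (((hPz.comp (f.skew.measurable.iterate n)).inv.mul
      (measurable_cocycleIter f.skew.measurable A.measurable_toFun n)).mul hPz)
      hH.isClosed.measurableSet
  have hW : ∀ᵐ z ∂(barMeasure p μ), ∀ n, z ∈ W n := by
    have h1 : ∀ᵐ z ∂(barMeasure p μ), ∀ n, B.toFun (f.skew^[n] z) =
        (P (f.fiber ((f.skew^[n] z).1 0) (f.skew^[n] z).2))⁻¹ * A.toFun (f.skew^[n] z) *
          P (f.skew^[n] z).2 :=
      ae_all_iff.2 fun n => (hf.iterate n).quasiMeasurePreserving.ae hPB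
    filter_upwards [h1] with z hz n
    induction n with
    | zero => simp [W, cocycleIter, H.one_mem]
    | succ n ih =>
      have h2 : (f.skew^[n + 1] z).2 =
          f.fiber ((f.skew^[n] z).1 0) (f.skew^[n] z).2 := by
        rw [Function.iterate_succ_apply', ← Prod.mk.eta (p := f.skew^[n] z), f.skew_apply]
      have h3 := hz n
      have h4 := H.mul_mem (h3 ▸ hB (f.skew^[n] z)) ih
      change (P (f.skew^[n + 1] z).2)⁻¹ * cocycleIter f.skew A.toFun (n + 1) z * P z.2 ∈ H
      rw [h2, cocycleIter]
      convert h4 using 1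
      group
  have hcover : ⋃ j, {z : (ℤ → Y) × X | P z.2 ∈ compactCovering G j} = Set.univ :=
    Set.eq_univ_of_forall fun z => Set.mem_iUnion.2 (exists_mem_compactCovering (P z.2))
  have hCm : ∀ j, MeasurableSet {z : (ℤ → Y) × X | P z.2 ∈ compactCovering G j} := fun j =>
    hPz (isCompact_compactCovering G j).isClosed.measurableSet
  -- `C` is a set of positive measure on which `P` is bounded.
  obtain ⟨j, hj⟩ : ∃ j, 0 < barMeasure p μ {z | P z.2 ∈ compactCovering G j} := by
    refine exists_measure_pos_of_not_measure_iUnion_null ?_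
    rw [hcover, measure_univ]
    exact one_ne_zero
  set C : Set ((ℤ → Y) × X) := {z | P z.2 ∈ compactCovering G j}
  have hCpos : 0 < (barMeasure p μ).real C := ENNReal.toReal_pos hj.ne' (measure_ne_top _ _)
  set δ := (barMeasure p μ).real C / 2
  set E₀ := {z | ∀ n : ℕ, δ * n ≤ birkhoffSum f.skew (C.indicator fun _ => (1 : ℝ)) n z}
  have hE₀ : 0 < barMeasure p μ E₀ :=
    measure_birkhoffSum_ge_pos hf (hCm j) (half_lt_self hCpos)
  -- The definition of essential boundedness asks for a measurable set.
  have hE₀m : MeasurableSet E₀ := by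
    have hInter : E₀ = ⋂ n : ℕ, {z | δ * n ≤
        birkhoffSum f.skew (C.indicator fun _ => (1 : ℝ)) n z} :=
      Set.ext fun z => ⟨fun h => Set.mem_iInter.2 h, fun h => Set.mem_iInter.1 h⟩
    rw [hInter]
    refine MeasurableSet.iInter fun n => ?_
    refine measurableSet_le measurable_const ?_
    exact Finset.measurable_sum _ fun k _ =>
      (measurable_const.indicator (hCm j)).comp (f.skew.measurable.iterate k)
  obtain ⟨k, hk⟩ : ∃ k, 0 < barMeasure p μ (E₀ ∩ {z | P z.2 ∈ compactCovering G k}) := by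
    refine exists_measure_pos_of_not_measure_iUnion_null ?_
    rw [← Set.inter_iUnion, hcover, Set.inter_univ]
    exact hE₀.ne'
  have hWE : (⋂ n, W n) ∈ ae (barMeasure p μ) := by
    filter_upwards [hW] with z hz
    exact Set.mem_iInter.2 hz
  refine ⟨compactCovering G j * (H : Set G) * (compactCovering G k)⁻¹, δ,
    (E₀ ∩ {z | P z.2 ∈ compactCovering G k}) ∩ ⋂ n, W n,
    ((isCompact_compactCovering G j).mul hH).mul (isCompact_compactCovering G k).inv,
    half_pos hCpos, (hE₀m.inter (hCm k)).inter (MeasurableSet.iInter hWm), ?_, ?_⟩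
  · rwa [measure_inter_conull hWE]
  · rintro z ⟨⟨hz₀, hzk⟩, hzW⟩
    refine le_lowerAsymptoticDensity (fun n => (hz₀ n).trans ?_) (half_pos hCpos).le
    refine Finset.sum_le_sum fun l _ => ?_
    by_cases hl : f.skew^[l] z ∈ C
    · rw [Set.indicator_of_mem hl, Set.indicator_of_mem]
      refine ⟨P (f.skew^[l] z).2 *
        ((P (f.skew^[l] z).2)⁻¹ * cocycleIter f.skew A.toFun l z * P z.2),
        Set.mul_mem_mul hl (Set.mem_iInter.1 hzW l), (P z.2)⁻¹, Set.inv_mem_inv.2 hzk, ?_⟩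
      change P (f.skew^[l] z).2 *
        ((P (f.skew^[l] z).2)⁻¹ * cocycleIter f.skew A.toFun l z * P z.2) * (P z.2)⁻¹ = _
      group
    · rw [Set.indicator_of_notMem hl]
      exact Set.indicator_nonneg (fun _ _ => zero_le_one) l

end RandomCocycle

end Converse

theorem mainTheorem8 {Y X G : Type*}
    [MeasurableSpace Y] (p : Measure Y) [IsProbabilityMeasure p]
    [MeasurableSpace X] [StandardBorelSpace X] (μ : Measure X) [IsProbabilityMeasure μ]
    [Group G] [TopologicalSpace G] [IsTopologicalGroup G] [LocallyCompactSpace G]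
    [T2Space G] [SecondCountableTopology G] [MeasurableSpace G] [BorelSpace G]
    (f : RandomTransformation Y X) (hf : Ergodic f.skew (barMeasure p μ))
    (A : RandomCocycle p μ G) :
    List.TFAE [
      A.IsEssentiallyBounded f,
      ∃ m : Measure (X × G), IsProbabilityMeasure m ∧ A.IsStationary f m,
      ∃ (H : Subgroup G) (B : RandomCocycle p μ G), IsCompact (H : Set G) ∧
        (∀ z, B.toFun z ∈ H) ∧ A.IsCohomologous f B] := by
  have hmp := hf.toMeasurePreserving
  tfae_have 1 → 3 := by
    intro h
    obtain ⟨ζ, hζ, hinv⟩ := h.exists_invariant f A hmp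
    exact A.exists_compact_reduction_of_invariant f hf hζ hinv
  tfae_have 2 → 3 := by
    rintro ⟨m, hm, h⟩
    obtain ⟨ζ, hζ, hinv⟩ := h.exists_invariant f A hmp
    exact A.exists_compact_reduction_of_invariant f hf hζ hinv
  tfae_have 3 → 1 := by
    rintro ⟨H, B, hH, hB, hAB⟩
    exact A.isEssentiallyBounded_of_compact_reduction f hmp hH hB hAB
  tfae_have 3 → 2 := by
    rintro ⟨H, B, hH, hB, hAB⟩
    exact A.exists_isStationary_of_compact_reduction f hmp hH hB hAB
  tfae_finish
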